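/- **Theorem (Existence of HOMO-LUMO excitations).** Let $\Omega\subset\mathbb{R}^3$ be open and bounded, let $\Omega_{nuc}\subset\Omega$ be compact, and let $n\ge 1$ be an integer. Let $e_{xc}:[0,\infty)\to\mathbb{R}$ be continuously differentiable, with derivative $v_{xc}=e_{xc}'$ (one-sided at $0$), and suppose that for some $1\le p<\tfrac53$ and some constant $c_{xc}$ one has $|e_{xc}(\rho)|\le c_{xc}(1+\rho^p)$ and $|v_{xc}(\rho)|\le c_{xc}(1+\rho^{p-1})$ for all $\rho\ge 0$. Let $\mathcal{A}_{nuc}$ be the set of nonnegative Radon measures on $\Omega_{nuc}$ of total mass $2n$. Let $H^1_0(\Omega)$ be the closure of $C_c^\infty(\Omega;\mathbb{C})$ in $H^1(\Omega;\mathbb{C})$, let $\langle u,v\rangle=\int_\Omega\overline{u}\,v\,dx$, and let $\mathcal{A}=\{(\phi_1,\dots,\phi_n)\in H^1_0(\Omega)^n:\langle\phi_i,\phi_j\rangle=\delta_{ij}\}$. For $\mu\in\mathcal{A}_{nuc}$ and $\phi\in\mathcal{A}$ put $$\rho(x)=2\sum_{i=1}^n|\phi_i(x)|^2,\qquad v_{ext}(x)=-\int_{\Omega_{nuc}}\frac{d\mu(y)}{|x-y|},\qquad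 v_H(x)=\int_\Omega\frac{\rho(y)}{|x-y|}\,dy,$$ and define the excitation functional $$\mathcal{E}_{\mu,\phi}[\chi]=\frac12\int_\Omega|\nabla\chi|^2\,dx+\int_\Omega\bigl(v_{ext}+v_H+v_{xc}(\rho)\bigr)|\chi|^2\,dx .$$ Then for every $\mu\in\mathcal{A}_{nuc}$ and every $\phi\in\mathcal{A}$: 1. $\mathcal{E}_{\mu,\phi}[\chi]$ is well defined for every $\chi\in H^1_0(\Omega)$: the integrals defining $v_{ext}(x)$ and $v_H(x)$ converge absolutely for almost every $x\in\Omega$, and $|\nabla\chi|^2$, $v_{ext}|\chi|^2$, $v_H|\chi|^2$ and $v_{xc}(\rho)|\chi|^2$ are integrable over $\Omega$; 2. $\mathcal{E}_{\mu,\phi}$ attains its maximum on $\mathcal{A}^H_\phi=\{\chi\in\mathrm{Span}_{\mathbb{C}}\{\phi_1,\dots,\phi_n\}:\langle\chi,\chi\rangle=1\}$, i.e. there is a HOMO; 3. $\mathcal{E}_{\mu,\phi}$ attains its minimum on $\mathcal{A}^L_\phi=\{\chi\in H^1_0(\Omega):\langle\phi_i,\chi\rangle=0\ (i=1,\dots,n),\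 \langle\chi,\chi\rangle=1\}$, i.e. there is a LUMO. -/

import Mathlib

open MeasureTheory Filter Topology

noncomputable section

namespace KohnSham

/-- Physical space `ℝ³`. -/
abbrev E3 : Type := EuclideanSpace ℝ (Fin 3)

/-- The complex Hilbert space `L²(Ω)`, with inner product `⟨u, v⟩ = ∫_Ω conj u · v`. -/
abbrev L2 (Ω : TopologicalSpace.Opens E3) : Type :=
  Lp ℂ 2 (volume.restrict (Ω : Set E3))

/-- The space `L²(Ω; ℂ³)` of square-integrable complex vector fields. -/
abbrev L2Vec (Ω : TopologicalSpace.Opens E3) : Type :=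
  Lp (EuclideanSpace ℂ (Fin 3)) 2 (volume.restrict (Ω : Set E3))

/-- The classical gradient `(∂₁f, ∂₂f, ∂₃f)` of a function `f : ℝ³ → ℂ`. -/
def classicalGradient (f : E3 → ℂ) (x : E3) : EuclideanSpace ℂ (Fin 3) :=
  WithLp.toLp 2 fun i => fderiv ℝ f x (EuclideanSpace.single i 1)

/-- `g` is the weak (distributional) gradient of `u` in `Ω`:
`∫_Ω u ∂ᵢη = -∫_Ω gᵢ η` for every real test function `η ∈ C_c^∞(Ω)` and every `i`. -/
def IsWeakGradient (Ω : TopologicalSpace.Opens E3) (u : L2 Ω) (g : L2Vec Ω) : Prop :=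
  ∀ (η : TestFunction Ω ℝ ⊤) (i : Fin 3),
    ∫ x in (Ω : Set E3), (fderiv ℝ η x (EuclideanSpace.single i 1)) • u x
      = -∫ x in (Ω : Set E3), η x • g x i

/-- Weak gradients are unique. -/
theorem IsWeakGradient.unique {Ω : TopologicalSpace.Opens E3} {u : L2 Ω} {g h : L2Vec Ω}
    (hg : IsWeakGradient Ω u g) (hh : IsWeakGradient Ω u h) : g = h := by
  have memi : ∀ (k : L2Vec Ω) (i : Fin 3),
      MemLp (fun x => k x i) 2 (volume.restrict (Ω : Set E3)) := fun k i =>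
    (EuclideanSpace.proj i : EuclideanSpace ℂ (Fin 3) →L[ℂ] ℂ).comp_memLp' (Lp.memLp k)
  have loci : ∀ (k : L2Vec Ω) (i : Fin 3),
      LocallyIntegrable (fun x => k x i) (volume.restrict (Ω : Set E3)) := fun k i =>
    (memi k i).locallyIntegrable (by norm_num)
  have key : ∀ i : Fin 3, ∀ᵐ x ∂(volume.restrict (Ω : Set E3)), g x i = h x i := by
    intro i
    have hloc : LocallyIntegrableOn (fun x => g x i - h x i) (Ω : Set E3)
        (volume.restrict (Ω : Set E3)) := ((loci g i).sub (loci h i)).locallyIntegrableOn _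
    have h0 := Ω.isOpen.ae_eq_zero_of_integral_contDiff_smul_eq_zero hloc (by
      intro η h1 h2 h3
      have e1 := hg ⟨η, h1, h2, h3⟩ i
      have e2 := hh ⟨η, h1, h2, h3⟩ i
      have int : ∀ k : L2Vec Ω, Integrable (fun x => η x • k x i)
          (volume.restrict (Ω : Set E3)) := fun k =>
        (loci k i).integrable_smul_left_of_hasCompactSupport h1.continuous h2
      have e3 := e1.symm.trans e2
      simp only [smul_sub]
      rw [integral_sub (int g) (int h), sub_eq_zero]
      exact neg_injective e3)
    have hΩ : ∀ᵐ x ∂(volume.restrict (Ω : Set E3)), x ∈ (Ω : Set E3) :=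
      ae_restrict_mem Ω.isOpen.measurableSet
    filter_upwards [h0, hΩ] with x hx hxΩ
    exact sub_eq_zero.mp (hx hxΩ)
  apply Lp.ext
  filter_upwards [ae_all_iff.mpr key] with x hx
  ext i
  exact hx i

open Classical in
/-- The weak gradient `∇u ∈ L²(Ω; ℂ³)`, for `u` that has one (and `0` otherwise). -/
def weakGradient (Ω : TopologicalSpace.Opens E3) (u : L2 Ω) : L2Vec Ω :=
  if h : ∃ g, IsWeakGradient Ω u g then h.choose else 0

theorem IsWeakGradient.weakGradient_eq {Ω : TopologicalSpace.Opens E3} {u : L2 Ω} {g : L2Vec Ω}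
    (hg : IsWeakGradient Ω u g) : weakGradient Ω u = g := by
  have h : ∃ g, IsWeakGradient Ω u g := ⟨g, hg⟩
  rw [weakGradient, dif_pos h]
  exact h.choose_spec.unique hg

/-- The Sobolev space `H¹₀(Ω)`: the functions `u ∈ L²(Ω)` with weak gradient in `L²(Ω; ℂ³)` that
are limits, in the `H¹` norm, of smooth functions with compact support in `Ω`. -/
def H10 (Ω : TopologicalSpace.Opens E3) : Set (L2 Ω) :=
  {u | (∃ g, IsWeakGradient Ω u g) ∧
    ∃ f : ℕ → TestFunction Ω ℂ ⊤,
      Tendsto (fun k => eLpNorm (fun x => f k x - u x) 2 (volume.restrict (Ω : Set E3)))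
        atTop (𝓝 0) ∧
      Tendsto (fun k => eLpNorm (fun x => classicalGradient (f k) x - weakGradient Ω u x) 2
        (volume.restrict (Ω : Set E3))) atTop (𝓝 0)}

/-- The exchange-correlation potential `v_xc = d e_xc / dρ` on `[0, ∞)` (one-sided derivative
at `0`). -/
def vxc (exc : ℝ → ℝ) (r : ℝ) : ℝ := derivWithin exc (Set.Ici 0) r

/-- The assumptions on the exchange-correlation energy density `e_xc : [0, ∞) → ℝ`; the values of
`exc` at negative arguments are irrelevant. -/
def AdmissibleXC (exc : ℝ → ℝ) : Prop :=
  ContDiffOn ℝ 1 exc (Set.Ici 0) ∧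
    ∃ p c : ℝ, 1 ≤ p ∧ p < 5 / 3 ∧
      ∀ r : ℝ, 0 ≤ r → |exc r| ≤ c * (1 + r ^ p) ∧ |vxc exc r| ≤ c * (1 + r ^ (p - 1))

/-- The admissible nuclear charge distributions: nonnegative Borel (hence Radon) measures of total
mass `2n` carried by `Ωnuc`. -/
def nuclearMeasures (Ωnuc : Set E3) (n : ℕ) : Set (Measure E3) :=
  {μ | μ Ωnucᶜ = 0 ∧ μ Ωnuc = 2 * (n : ENNReal)}

/-- The admissible orbitals: `L²`-orthonormal `n`-tuples in `H¹₀(Ω)`. -/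
def admissibleOrbitals (Ω : TopologicalSpace.Opens E3) (n : ℕ) : Set (Fin n → L2 Ω) :=
  {φ | (∀ i, φ i ∈ H10 Ω) ∧ Orthonormal ℂ φ}

/-- The electron density `ρ(x) = 2 ∑ᵢ |φᵢ(x)|²`. -/
def density {Ω : TopologicalSpace.Opens E3} {n : ℕ} (φ : Fin n → L2 Ω) (x : E3) : ℝ :=
  2 * ∑ i, ‖φ i x‖ ^ 2

/-- The external potential `v_ext(x) = -∫_{Ωnuc} 1/|x-y| dμ(y)`. -/
def vext (Ωnuc : Set E3) (μ : Measure E3) (x : E3) : ℝ :=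
  -∫ y in Ωnuc, 1 / ‖x - y‖ ∂μ

/-- The Hartree potential `v_H(x) = ∫_Ω ρ(y)/|x-y| dy`. -/
def vH {Ω : TopologicalSpace.Opens E3} {n : ℕ} (φ : Fin n → L2 Ω) (x : E3) : ℝ :=
  ∫ y in (Ω : Set E3), density φ y / ‖x - y‖

/-- The excitation functional
`ℰ_{μ,φ}[χ] = ½ ∫_Ω |∇χ|² + ∫_Ω (v_ext + v_H + v_xc(ρ)) |χ|²`. -/
def excitationFunctional {Ω : TopologicalSpace.Opens E3} {n : ℕ}
    (exc : ℝ → ℝ) (Ωnuc : Set E3) (μ : Measure E3) (φ : Fin n → L2 Ω)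
    (χ : L2 Ω) : ℝ :=
  1 / 2 * (∫ x in (Ω : Set E3), ‖weakGradient Ω χ x‖ ^ 2) +
    ∫ x in (Ω : Set E3), (vext Ωnuc μ x + vH φ x + vxc exc (density φ x)) * ‖χ x‖ ^ 2

/-- All the integrals in the excitation functional at `χ`, including those that define the
potentials at almost every point of `Ω`, converge absolutely. -/
def ExcitationWellDefined {Ω : TopologicalSpace.Opens E3} {n : ℕ}
    (exc : ℝ → ℝ) (Ωnuc : Set E3) (μ : Measure E3) (φ : Fin n → L2 Ω)
    (χ : L2 Ω) : Prop :=
  (∀ᵐ x ∂(volume.restrict (Ω : Set E3)),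
      IntegrableOn (fun y => 1 / ‖x - y‖) Ωnuc μ ∧
      IntegrableOn (fun y => density φ y / ‖x - y‖) (Ω : Set E3)) ∧
    IntegrableOn (fun x => ‖weakGradient Ω χ x‖ ^ 2) (Ω : Set E3) ∧
    IntegrableOn (fun x => vext Ωnuc μ x * ‖χ x‖ ^ 2) (Ω : Set E3) ∧
    IntegrableOn (fun x => vH φ x * ‖χ x‖ ^ 2) (Ω : Set E3) ∧
    IntegrableOn (fun x => vxc exc (density φ x) * ‖χ x‖ ^ 2) (Ω : Set E3)

/-- The candidate HOMOs: unit vectors in the span of the orbitals. -/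
def homoSet {Ω : TopologicalSpace.Opens E3} {n : ℕ} (φ : Fin n → L2 Ω) : Set (L2 Ω) :=
  {χ | χ ∈ Submodule.span ℂ (Set.range φ) ∧ inner ℂ χ χ = 1}

/-- The candidate LUMOs: unit vectors in `H¹₀(Ω)` orthogonal to all orbitals. -/
def lumoSet {Ω : TopologicalSpace.Opens E3} {n : ℕ} (φ : Fin n → L2 Ω) : Set (L2 Ω) :=
  {χ | χ ∈ H10 Ω ∧ (∀ i, inner ℂ (φ i) χ = 0) ∧ inner ℂ χ χ = 1}

end KohnSham

end

/-! Everything reduces to one quadratic form, `½‖∇u‖² + ∫ V|u|²` with `V = v_ext + v_H + v_xc(ρ)`.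
The set `H10 Ω` is replaced by `sobolevGraph Ω`, the closed linear graph of the weak gradient, whose
first projection is injective with image `H10 Ω`.

The potential `V` lies in `L^{3/2}(Ω)`. Since `1/|x|` is locally square integrable in dimension
three, a finite measure has its Coulomb potential in `L²` of a bounded set. Since `p - 1 < 2/3` and
`ρ ∈ L¹`, also `v_xc(ρ) ∈ L^{3/2}`. The Sobolev embedding into `L⁶` and Hölder make `V|u|²`
integrable. Splitting `V` into a part of small `L^{3/2}` norm and a bounded part gives `∫ |V||u|² ≤
ε‖∇u‖² + C‖u‖²` (`exists_form_bound`). The form is therefore continuous in the graph norm and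
coercive modulo `‖u‖²`.

The HOMO is then the maximum of a continuous function on the unit sphere of a finite-dimensional
space. The LUMO comes from a minimizing sequence: coercivity bounds it, Rellich compactness makes a
subsequence Cauchy in `L²`, and the parallelogram identity upgrades this to convergence of the
gradients (`exists_isMinOn_energyForm`). The limit is strong, so no weak lower semicontinuity is
needed. -/

noncomputable section

namespace KohnSham

/-! ### The graph of the weak gradient on `H¹₀(Ω)` -/

section SobolevGraph

variable {Ω : TopologicalSpace.Opens E3}

theorem classicalGradient_apply (f : E3 → ℂ) (x : E3) (i : Fin 3) :
    classicalGradient f x i = fderiv ℝ f x (EuclideanSpace.single i 1) := rfl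

theorem continuous_classicalGradient {f : E3 → ℂ} (hf : ContDiff ℝ (⊤ : ℕ∞) f) :
    Continuous (classicalGradient f) := by
  refine (PiLp.continuous_toLp 2 _).comp (continuous_pi fun i => ?_)
  exact (hf.continuous_fderiv (by simp)).clm_apply continuous_const

theorem tsupport_classicalGradient_subset (f : E3 → ℂ) :
    tsupport (classicalGradient f) ⊆ tsupport f := by
  refine (closure_mono ?_).trans (tsupport_fderiv_subset ℝ (f := f))
  intro x hx
  contrapose! hx
  simp only [Function.mem_support, not_not] at hx ⊢
  ext i
  simp [classicalGradient_apply, hx]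

theorem classicalGradient_eq_zero_of_notMem (f : TestFunction Ω ℂ ⊤) {x : E3}
    (hx : x ∉ (Ω : Set E3)) : classicalGradient f x = 0 :=
  image_eq_zero_of_notMem_tsupport
    fun h => hx (f.tsupport_subset (tsupport_classicalGradient_subset f h))

theorem testFunction_eq_zero_of_notMem {F : Type*} [NormedAddCommGroup F] [NormedSpace ℝ F]
    (f : TestFunction Ω F ⊤) {x : E3} (hx : x ∉ (Ω : Set E3)) : f x = 0 :=
  image_eq_zero_of_notMem_tsupport fun h => hx (f.tsupport_subset h)

theorem hasCompactSupport_classicalGradient (f : TestFunction Ω ℂ ⊤) :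
    HasCompactSupport (classicalGradient f) :=
  f.hasCompactSupport.of_isClosed_subset (isClosed_tsupport _)
    (tsupport_classicalGradient_subset f)

theorem memLp_testFunction {F : Type*} [NormedAddCommGroup F] [NormedSpace ℝ F]
    (f : TestFunction Ω F ⊤) (p : ENNReal) (ν : Measure E3) [IsFiniteMeasureOnCompacts ν] :
    MemLp f p ν :=
  f.continuous.memLp_of_hasCompactSupport f.hasCompactSupport

theorem memLp_classicalGradient (f : TestFunction Ω ℂ ⊤) (p : ENNReal) (ν : Measure E3)
    [IsFiniteMeasureOnCompacts ν] : MemLp (classicalGradient f) p ν :=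
  (continuous_classicalGradient f.contDiff).memLp_of_hasCompactSupport
    (hasCompactSupport_classicalGradient f)

/-- A test function together with its gradient, as an element of `L²(Ω) × L²(Ω; ℂ³)`. -/
def testGraph (Ω : TopologicalSpace.Opens E3) : TestFunction Ω ℂ ⊤ →ₗ[ℂ] L2 Ω × L2Vec Ω where
  toFun f := ((memLp_testFunction f 2 _).toLp f, (memLp_classicalGradient f 2 _).toLp _)
  map_add' f g := by
    have h : classicalGradient (f + g : TestFunction Ω ℂ ⊤) =
        classicalGradient f + classicalGradient g := by
      ext x i
      have hf := (f.contDiff.differentiable (by simp)) x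
      have hg := (g.contDiff.differentiable (by simp)) x
      simp [classicalGradient_apply, FunLike.coe_add, fderiv_add hf hg]
    refine Prod.ext ?_ ?_
    · exact MemLp.toLp_add (memLp_testFunction f 2 _) (memLp_testFunction g 2 _)
    · simp only [h, Prod.mk_add_mk]
      exact MemLp.toLp_add (memLp_classicalGradient f 2 _) (memLp_classicalGradient g 2 _)
  map_smul' c f := by
    have h : classicalGradient (c • f : TestFunction Ω ℂ ⊤) = c • classicalGradient f := by
      ext x i
      have hf := (f.contDiff.differentiable (by simp)) x
      simp [classicalGradient_apply, FunLike.coe_smul, fderiv_const_smul hf]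
    refine Prod.ext ?_ ?_
    · exact MemLp.toLp_const_smul c (memLp_testFunction f 2 _)
    · simp only [h, RingHom.id_apply, Prod.smul_mk]
      exact MemLp.toLp_const_smul c (memLp_classicalGradient f 2 _)

theorem testGraph_fst (f : TestFunction Ω ℂ ⊤) :
    (testGraph Ω f).1 = (memLp_testFunction f 2 (volume.restrict (Ω : Set E3))).toLp f := rfl

theorem testGraph_snd (f : TestFunction Ω ℂ ⊤) :
    (testGraph Ω f).2 = (memLp_classicalGradient f 2 (volume.restrict (Ω : Set E3))).toLp _ := rfl

/-- The graph of the weak gradient on `H¹₀(Ω)`: the closure of the graph of the gradient on test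
functions. -/
def sobolevGraph (Ω : TopologicalSpace.Opens E3) : Submodule ℂ (L2 Ω × L2Vec Ω) :=
  (LinearMap.range (testGraph Ω)).topologicalClosure

theorem isClosed_sobolevGraph : IsClosed (sobolevGraph Ω : Set (L2 Ω × L2Vec Ω)) :=
  Submodule.isClosed_topologicalClosure _

theorem testGraph_mem (f : TestFunction Ω ℂ ⊤) : testGraph Ω f ∈ sobolevGraph Ω :=
  Submodule.le_topologicalClosure _ ⟨f, rfl⟩

theorem exists_seq_of_mem_sobolevGraph {w : L2 Ω × L2Vec Ω} (hw : w ∈ sobolevGraph Ω) :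
    ∃ f : ℕ → TestFunction Ω ℂ ⊤, Tendsto (fun k => testGraph Ω (f k)) atTop (𝓝 w) := by
  obtain ⟨s, hs, hlim⟩ := mem_closure_iff_seq_limit.mp
    (show w ∈ closure (LinearMap.range (testGraph Ω) : Set (L2 Ω × L2Vec Ω)) from hw)
  choose f hf using hs
  exact ⟨f, by simpa only [hf] using hlim⟩

theorem tendsto_testGraph_fst_iff (f : ℕ → TestFunction Ω ℂ ⊤) (u : L2 Ω) :
    Tendsto (fun k => (testGraph Ω (f k)).1) atTop (𝓝 u) ↔
      Tendsto (fun k => eLpNorm (fun x => f k x - u x) 2 (volume.restrict (Ω : Set E3)))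
        atTop (𝓝 0) := by
  have h := Lp.tendsto_Lp_iff_tendsto_eLpNorm'' (fi := atTop) (fun k => (f k : E3 → ℂ))
    (fun k => memLp_testFunction (f k) 2 (volume.restrict (Ω : Set E3))) u (Lp.memLp u)
  rwa [Lp.toLp_coeFn] at h

theorem tendsto_testGraph_snd_iff (f : ℕ → TestFunction Ω ℂ ⊤) (g : L2Vec Ω) :
    Tendsto (fun k => (testGraph Ω (f k)).2) atTop (𝓝 g) ↔
      Tendsto (fun k => eLpNorm (fun x => classicalGradient (f k) x - g x) 2
        (volume.restrict (Ω : Set E3))) atTop (𝓝 0) := by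
  have h := Lp.tendsto_Lp_iff_tendsto_eLpNorm'' (fi := atTop) (fun k => classicalGradient (f k))
    (fun k => memLp_classicalGradient (f k) 2 (volume.restrict (Ω : Set E3))) g (Lp.memLp g)
  rwa [Lp.toLp_coeFn] at h

/-- Writing the tested integral as an `L²` inner product makes it continuous in `u`; with the
companion lemma for `g`, the weak gradient identity survives `L²` limits. -/
theorem integral_testFunction_smul_eq_inner (η : TestFunction Ω ℝ ⊤) (v : E3) :
    ∃ h : L2 Ω, ∀ u : L2 Ω, ∫ x in (Ω : Set E3), (fderiv ℝ η x v) • u x = inner ℂ h u := by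
  have hc : Continuous fun x => ((fderiv ℝ η x v : ℝ) : ℂ) :=
    Complex.continuous_ofReal.comp
      ((η.contDiff.continuous_fderiv (by simp)).clm_apply continuous_const)
  have hs : HasCompactSupport fun x => ((fderiv ℝ η x v : ℝ) : ℂ) :=
    (η.hasCompactSupport.fderiv_apply ℝ v).comp_left Complex.ofReal_zero
  have hm := hc.memLp_of_hasCompactSupport (p := 2) (μ := volume.restrict (Ω : Set E3)) hs
  refine ⟨hm.toLp _, fun u => ?_⟩
  rw [L2.inner_def]
  refine integral_congr_ae ?_
  filter_upwards [hm.coeFn_toLp] with x hx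
  rw [hx]
  simp [mul_comm]

theorem integral_testFunction_smul_apply_eq_inner (η : TestFunction Ω ℝ ⊤) (i : Fin 3) :
    ∃ h : L2Vec Ω, ∀ g : L2Vec Ω, ∫ x in (Ω : Set E3), η x • g x i = inner ℂ h g := by
  have hc : Continuous fun x => (EuclideanSpace.single i ((η x : ℝ) : ℂ)) := by
    refine (PiLp.continuous_toLp 2 _).comp ?_
    exact (continuous_single i).comp (Complex.continuous_ofReal.comp η.continuous)
  have hs : HasCompactSupport fun x => (EuclideanSpace.single i ((η x : ℝ) : ℂ)) :=
    η.hasCompactSupport.comp_left (g := fun t : ℝ => EuclideanSpace.single i (t : ℂ)) (by simp)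
  have hm := hc.memLp_of_hasCompactSupport (p := 2) (μ := volume.restrict (Ω : Set E3)) hs
  refine ⟨hm.toLp _, fun u => ?_⟩
  rw [L2.inner_def]
  refine integral_congr_ae ?_
  filter_upwards [hm.coeFn_toLp] with x hx
  rw [hx, EuclideanSpace.inner_single_left]
  simp

theorem isWeakGradient_testGraph (f : TestFunction Ω ℂ ⊤) :
    IsWeakGradient Ω (testGraph Ω f).1 (testGraph Ω f).2 := by
  intro η i
  have e1 : ∫ x in (Ω : Set E3), (fderiv ℝ η x (EuclideanSpace.single i 1)) • (testGraph Ω f).1 x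
      = ∫ x, (fderiv ℝ η x (EuclideanSpace.single i 1)) • f x := by
    rw [← setIntegral_eq_integral_of_forall_compl_eq_zero (s := (Ω : Set E3))
      (f := fun x => (fderiv ℝ η x (EuclideanSpace.single i 1)) • f x)
      fun x hx => by rw [testFunction_eq_zero_of_notMem f hx, smul_zero]]
    refine integral_congr_ae ?_
    filter_upwards [(memLp_testFunction f 2 (volume.restrict (Ω : Set E3))).coeFn_toLp] with x hx
    rw [testGraph_fst, hx]
  have e2 : ∫ x in (Ω : Set E3), η x • (testGraph Ω f).2 x i
      = ∫ x, η x • fderiv ℝ f x (EuclideanSpace.single i 1) := by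
    rw [← setIntegral_eq_integral_of_forall_compl_eq_zero (s := (Ω : Set E3))
      (f := fun x => η x • fderiv ℝ f x (EuclideanSpace.single i 1))
      fun x hx => by rw [testFunction_eq_zero_of_notMem η hx, zero_smul]]
    refine integral_congr_ae ?_
    filter_upwards [(memLp_classicalGradient f 2 (volume.restrict (Ω : Set E3))).coeFn_toLp]
      with x hx
    rw [testGraph_snd, hx, classicalGradient_apply]
  have cη : Continuous fun x => fderiv ℝ η x (EuclideanSpace.single i 1) :=
    (η.contDiff.continuous_fderiv (by simp)).clm_apply continuous_const
  have cf : Continuous fun x => fderiv ℝ f x (EuclideanSpace.single i 1) :=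
    (f.contDiff.continuous_fderiv (by simp)).clm_apply continuous_const
  rw [e1, e2, integral_smul_fderiv_eq_neg_fderiv_smul_of_integrable, neg_neg]
  · exact (cη.smul f.continuous).integrable_of_hasCompactSupport f.hasCompactSupport.smul_left
  · exact (η.continuous.smul cf).integrable_of_hasCompactSupport η.hasCompactSupport.smul_right
  · exact (η.continuous.smul f.continuous).integrable_of_hasCompactSupport
      η.hasCompactSupport.smul_right
  · exact fun x _ => (η.contDiff.differentiable (by simp)) x
  · exact fun x _ => (f.contDiff.differentiable (by simp)) x

theorem isWeakGradient_of_mem_sobolevGraph {w : L2 Ω × L2Vec Ω} (hw : w ∈ sobolevGraph Ω) :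
    IsWeakGradient Ω w.1 w.2 := by
  obtain ⟨f, hf⟩ := exists_seq_of_mem_sobolevGraph hw
  intro η i
  obtain ⟨h, hh⟩ := integral_testFunction_smul_eq_inner η (EuclideanSpace.single i 1)
  obtain ⟨k, hk⟩ := integral_testFunction_smul_apply_eq_inner η i
  have e : ∀ j, inner ℂ h (testGraph Ω (f j)).1 = -inner ℂ k (testGraph Ω (f j)).2 := fun j => by
    rw [← hh, ← hk]
    exact isWeakGradient_testGraph (f j) η i
  rw [hh, hk]
  refine tendsto_nhds_unique ((tendsto_const_nhds (x := h)).inner (hf.fst_nhds)) ?_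
  simp_rw [e]
  exact ((tendsto_const_nhds (x := k)).inner hf.snd_nhds).neg

theorem weakGradient_eq_of_mem_sobolevGraph {w : L2 Ω × L2Vec Ω} (hw : w ∈ sobolevGraph Ω) :
    weakGradient Ω w.1 = w.2 :=
  (isWeakGradient_of_mem_sobolevGraph hw).weakGradient_eq

theorem mem_H10_of_mem_sobolevGraph {w : L2 Ω × L2Vec Ω} (hw : w ∈ sobolevGraph Ω) :
    w.1 ∈ H10 Ω := by
  refine ⟨⟨w.2, isWeakGradient_of_mem_sobolevGraph hw⟩, ?_⟩
  rw [weakGradient_eq_of_mem_sobolevGraph hw]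
  obtain ⟨f, hf⟩ := exists_seq_of_mem_sobolevGraph hw
  exact ⟨f, (tendsto_testGraph_fst_iff f _).mp hf.fst_nhds,
    (tendsto_testGraph_snd_iff f _).mp hf.snd_nhds⟩

/-- Together with `mem_H10_of_mem_sobolevGraph` this identifies `H10 Ω` with the graph, where
linearity and closedness are available. -/
theorem mem_sobolevGraph_of_mem_H10 {u : L2 Ω} (hu : u ∈ H10 Ω) :
    (u, weakGradient Ω u) ∈ sobolevGraph Ω := by
  obtain ⟨-, f, h1, h2⟩ := hu
  exact isClosed_sobolevGraph.mem_of_tendsto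
    (((tendsto_testGraph_fst_iff f _).mpr h1).prodMk_nhds
      ((tendsto_testGraph_snd_iff f _).mpr h2))
    (Eventually.of_forall fun k => testGraph_mem (f k))

end SobolevGraph

/-! ### Sobolev inequality and form bounds for `L^{3/2}` potentials -/

section FormBounds

variable {Ω : TopologicalSpace.Opens E3}

/-- A real direction `v`, viewed as a complex vector of the same norm, pairs with the gradient to
give the directional derivative; Cauchy–Schwarz concludes. -/
theorem norm_fderiv_le_norm_classicalGradient (f : E3 → ℂ) (x : E3) :
    ‖fderiv ℝ f x‖ ≤ ‖classicalGradient f x‖ := by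
  refine ContinuousLinearMap.opNorm_le_bound _ (norm_nonneg _) fun v => ?_
  let c : EuclideanSpace ℂ (Fin 3) := WithLp.toLp 2 fun i => (v i : ℂ)
  have hc : ‖c‖ = ‖v‖ := by
    simp [EuclideanSpace.norm_eq, c]
  have hv : fderiv ℝ f x v = inner ℂ c (classicalGradient f x) := by
    conv_lhs => rw [← (EuclideanSpace.basisFun (Fin 3) ℝ).sum_repr v]
    simp [PiLp.inner_apply, c, classicalGradient_apply, mul_comm]
  rw [hv, mul_comm, ← hc]
  exact norm_inner_le_norm _ _

/-- On test functions this is Gagliardo–Nirenberg–Sobolev with `1/6 = 1/2 - 1/3`. Fatou along an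
almost everywhere convergent subsequence carries it to the closure. -/
theorem exists_sobolev_const : ∃ S : ℝ, 0 ≤ S ∧ ∀ (Ω : TopologicalSpace.Opens E3)
    (w : L2 Ω × L2Vec Ω), w ∈ sobolevGraph Ω →
      eLpNorm w.1 6 (volume.restrict (Ω : Set E3)) ≤ ENNReal.ofReal (S * ‖w.2‖) := by
  set S := SNormLESNormFDerivOfEqConst ℂ (volume : Measure E3) ((2 : NNReal) : ℝ)
  refine ⟨S, S.2, fun Ω w hw => ?_⟩
  have htest : ∀ f : TestFunction Ω ℂ ⊤, eLpNorm f 6 (volume.restrict (Ω : Set E3)) ≤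
      ENNReal.ofReal (S * ‖(testGraph Ω f).2‖) := fun f => by
    have h := eLpNorm_le_eLpNorm_fderiv_of_eq (μ := (volume : Measure E3)) (u := f)
      (f.contDiff.of_le (by exact_mod_cast le_top)) f.hasCompactSupport (p := 2) (p' := 6)
      (by norm_num) (by simp) (by rw [finrank_euclideanSpace_fin]; norm_num)
    calc eLpNorm f 6 (volume.restrict (Ω : Set E3)) ≤ eLpNorm f 6 volume :=
          eLpNorm_mono_measure _ Measure.restrict_le_self
      _ ≤ S * eLpNorm (fderiv ℝ f) 2 volume := by exact_mod_cast h
      _ ≤ S * eLpNorm (classicalGradient f) 2 volume := by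
          gcongr
          exact eLpNorm_mono (norm_fderiv_le_norm_classicalGradient f)
      _ = S * eLpNorm (classicalGradient f) 2 (volume.restrict (Ω : Set E3)) := by
          rw [eLpNorm_restrict_eq_of_support_subset]
          intro x hx
          by_contra hxΩ
          exact hx (classicalGradient_eq_zero_of_notMem f hxΩ)
      _ = ENNReal.ofReal (S * ‖(testGraph Ω f).2‖) := by
          rw [testGraph_snd, Lp.norm_toLp, ENNReal.ofReal_mul S.coe_nonneg,
            ENNReal.ofReal_toReal (memLp_classicalGradient f 2 _).2.ne, ENNReal.ofReal_coe_nnreal]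
  obtain ⟨f, hf⟩ := exists_seq_of_mem_sobolevGraph hw
  have hm : TendstoInMeasure (volume.restrict (Ω : Set E3)) (fun k => (f k : E3 → ℂ)) atTop w.1 :=
    tendstoInMeasure_of_tendsto_eLpNorm (p := 2) (by norm_num)
      (fun k => (f k).continuous.aestronglyMeasurable) (Lp.aestronglyMeasurable _)
      ((tendsto_testGraph_fst_iff f _).mp hf.fst_nhds)
  obtain ⟨ns, hns, hae⟩ := hm.exists_seq_tendsto_ae
  have hlim : Tendsto (fun k => ENNReal.ofReal (S * ‖(testGraph Ω (f (ns k))).2‖)) atTop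
      (𝓝 (ENNReal.ofReal (S * ‖w.2‖))) :=
    ENNReal.tendsto_ofReal
      ((hf.snd_nhds.norm.const_mul (S : ℝ)).comp hns.tendsto_atTop)
  calc eLpNorm w.1 6 (volume.restrict (Ω : Set E3))
      ≤ liminf (fun k => eLpNorm (f (ns k)) 6 (volume.restrict (Ω : Set E3))) atTop :=
        Lp.eLpNorm_lim_le_liminf_eLpNorm
          (fun k => (f (ns k)).continuous.aestronglyMeasurable) _ hae
    _ ≤ liminf (fun k => ENNReal.ofReal (S * ‖(testGraph Ω (f (ns k))).2‖)) atTop :=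
        liminf_le_liminf (Eventually.of_forall fun k => htest _)
    _ = _ := hlim.liminf_eq

instance holderTriple_three_halves_three_one : ENNReal.HolderTriple (3 / 2) 3 1 where
  inv_add_inv_eq_inv := by
    rw [ENNReal.inv_div (by simp) (by simp), inv_one, ← one_div, ENNReal.div_add_div_same]
    norm_num
    exact ENNReal.div_self (by simp) (by simp)

/-- Hölder with exponents `3/2` and `3`, as `|u|² ∈ L³`. -/
theorem integrable_mul_norm_sq_of_memLp {α : Type*} [MeasurableSpace α] {ν : Measure α}
    {V : α → ℝ} {u : α → ℂ} (hV : MemLp V (3 / 2) ν) (hu : MemLp u 6 ν) :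
    Integrable (fun x => V x * ‖u x‖ ^ 2) ν ∧
      ∫ x, |V x| * ‖u x‖ ^ 2 ∂ν ≤ (eLpNorm V (3 / 2) ν).toReal * (eLpNorm u 6 ν).toReal ^ 2 := by
  have e : eLpNorm (fun x => ‖u x‖ ^ 2) 3 ν = eLpNorm u 6 ν ^ 2 := by
    have h := eLpNorm_norm_rpow (p := 3) (μ := ν) u (q := 2) (by norm_num)
    rw [show (3 : ENNReal) * ENNReal.ofReal 2 = 6 by simp; norm_num] at h
    exact_mod_cast h
  have hu2 : MemLp (fun x => ‖u x‖ ^ 2) 3 ν :=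
    ⟨hu.1.norm.pow 2, by rw [e]; exact ENNReal.pow_lt_top hu.2⟩
  have hint : Integrable (fun x => V x * ‖u x‖ ^ 2) ν := by
    rw [← memLp_one_iff_integrable]
    exact hu2.mul' hV
  refine ⟨hint, ?_⟩
  have hb : eLpNorm (V • fun x => ‖u x‖ ^ 2) 1 ν ≤
      eLpNorm V (3 / 2) ν * eLpNorm (fun x => ‖u x‖ ^ 2) 3 ν :=
    eLpNorm_smul_le_mul_eLpNorm hu2.1 hV.1
  have e2 : ∫ x, |V x| * ‖u x‖ ^ 2 ∂ν = (eLpNorm (V • fun x => ‖u x‖ ^ 2) 1 ν).toReal := by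
    rw [eLpNorm_one_eq_lintegral_enorm,
      ← integral_norm_eq_lintegral_enorm (hV.1.smul hu2.1)]
    simp
  rw [e2, ← ENNReal.toReal_pow, ← ENNReal.toReal_mul, ← e]
  exact ENNReal.toReal_mono
    (by rw [e]; exact ENNReal.mul_ne_top hV.2.ne (ENNReal.pow_ne_top hu.2.ne)) hb

theorem memLp_six_of_mem_sobolevGraph {w : L2 Ω × L2Vec Ω} (hw : w ∈ sobolevGraph Ω) :
    MemLp w.1 6 (volume.restrict (Ω : Set E3)) := by
  obtain ⟨S, -, hS⟩ := exists_sobolev_const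
  exact ⟨Lp.aestronglyMeasurable _, (hS Ω w hw).trans_lt ENNReal.ofReal_lt_top⟩

theorem integrable_potential_mul_norm_sq {V : E3 → ℝ}
    (hV : MemLp V (3 / 2) (volume.restrict (Ω : Set E3))) {w : L2 Ω × L2Vec Ω}
    (hw : w ∈ sobolevGraph Ω) : IntegrableOn (fun x => V x * ‖w.1 x‖ ^ 2) (Ω : Set E3) :=
  (integrable_mul_norm_sq_of_memLp hV (memLp_six_of_mem_sobolevGraph hw)).1

theorem integral_norm_sq_eq {α F : Type*} [MeasurableSpace α] {ν : Measure α}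
    [NormedAddCommGroup F] [InnerProductSpace ℂ F] (u : Lp F 2 ν) :
    ∫ x, ‖u x‖ ^ 2 ∂ν = ‖u‖ ^ 2 := by
  have h := L2.inner_def (𝕜 := ℂ) u u
  simp_rw [inner_self_eq_norm_sq_to_K] at h
  norm_cast at h
  exact h.symm

/-- Potentials in `L^{3/2}` are infinitesimally form bounded with respect to the gradient. -/
theorem exists_form_bound {V : E3 → ℝ} (hV : MemLp V (3 / 2) (volume.restrict (Ω : Set E3)))
    {ε : ℝ} (hε : 0 < ε) : ∃ C : ℝ, 0 ≤ C ∧ ∀ w ∈ sobolevGraph Ω,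
      ∫ x in (Ω : Set E3), |V x| * ‖w.1 x‖ ^ 2 ≤ ε * ‖w.2‖ ^ 2 + C * ‖w.1‖ ^ 2 := by
  obtain ⟨S, hS0, hS⟩ := exists_sobolev_const
  set V' := hV.1.mk V
  have hVV' : V =ᵐ[volume.restrict (Ω : Set E3)] V' := hV.1.ae_eq_mk
  have hV' : MemLp V' (3 / 2) (volume.restrict (Ω : Set E3)) := (memLp_congr_ae hVV').mp hV
  -- The part of `V'` above the level `M` has norm at most `ε / (S² + 1)`, which absorbs the factor
  -- `S²` from the Sobolev inequality; the `+ 1` covers `S = 0`. The rest is bounded by `M`, which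
  -- serves as `C`.
  obtain ⟨M, hM0, hM⟩ := hV'.eLpNorm_indicator_norm_ge_pos_le hV.1.stronglyMeasurable_mk
    (ε := ε / (S ^ 2 + 1)) (by positivity)
  refine ⟨M, hM0.le, fun w hw => ?_⟩
  set A : Set E3 := {x | M ≤ ‖V' x‖₊}
  have hA : MeasurableSet A :=
    measurableSet_le measurable_const hV.1.stronglyMeasurable_mk.measurable.nnnorm.coe_nnreal_real
  have hVA : MemLp (A.indicator V') (3 / 2) (volume.restrict (Ω : Set E3)) := hV'.indicator hA
  obtain ⟨i1, b1⟩ := integrable_mul_norm_sq_of_memLp hVA (memLp_six_of_mem_sobolevGraph hw)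
  have hsq : Integrable (fun x => ‖w.1 x‖ ^ 2) (volume.restrict (Ω : Set E3)) :=
    (memLp_two_iff_integrable_sq_norm (Lp.aestronglyMeasurable _)).mp (Lp.memLp w.1)
  have i1' : Integrable (fun x => |A.indicator V' x| * ‖w.1 x‖ ^ 2)
      (volume.restrict (Ω : Set E3)) := by
    simpa [abs_mul] using i1.abs
  have h1 : (eLpNorm (A.indicator V') (3 / 2) (volume.restrict (Ω : Set E3))).toReal ≤
      ε / (S ^ 2 + 1) := ENNReal.toReal_le_of_le_ofReal (by positivity) hM
  have h2 : (eLpNorm w.1 6 (volume.restrict (Ω : Set E3))).toReal ≤ S * ‖w.2‖ :=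
    ENNReal.toReal_le_of_le_ofReal (by positivity) (hS Ω w hw)
  calc ∫ x in (Ω : Set E3), |V x| * ‖w.1 x‖ ^ 2
      ≤ ∫ x in (Ω : Set E3), (|A.indicator V' x| * ‖w.1 x‖ ^ 2 + M * ‖w.1 x‖ ^ 2) := by
        refine integral_mono_of_nonneg (Eventually.of_forall fun x => by positivity)
          (i1'.add (hsq.const_mul M)) ?_
        filter_upwards [hVV'] with x hx
        rw [hx, ← add_mul]
        gcongr
        by_cases hxA : x ∈ A
        · rw [Set.indicator_of_mem hxA]; linarith
        · rw [Set.indicator_of_notMem hxA]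
          have : ‖V' x‖ < M := not_le.mp hxA
          rw [Real.norm_eq_abs] at this
          simpa using this.le
    _ = (∫ x in (Ω : Set E3), |A.indicator V' x| * ‖w.1 x‖ ^ 2) + M * ‖w.1‖ ^ 2 := by
        rw [integral_add i1' (hsq.const_mul M), integral_const_mul, integral_norm_sq_eq]
    _ ≤ ε / (S ^ 2 + 1) * (S * ‖w.2‖) ^ 2 + M * ‖w.1‖ ^ 2 := by
        gcongr
        exact b1.trans (by gcongr)
    _ ≤ ε * ‖w.2‖ ^ 2 + M * ‖w.1‖ ^ 2 := by
        refine add_le_add_left ?_ _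
        rw [div_mul_eq_mul_div, div_le_iff₀ (by positivity)]
        nlinarith [mul_nonneg hε.le (sq_nonneg ‖w.2‖)]

end FormBounds

/-! ### Rellich compactness by the Fourier transform -/

section Rellich

open scoped FourierTransform SchwartzMap LineDeriv

variable {Ω : TopologicalSpace.Opens E3}

/-- A bounded sequence in a separable Hilbert space has a subsequence that converges weakly. -/
theorem exists_subseq_tendsto_inner {H : Type*} [NormedAddCommGroup H] [InnerProductSpace ℂ H]
    [TopologicalSpace.SeparableSpace H] {v : ℕ → H} {B : ℝ} (hv : ∀ k, ‖v k‖ ≤ B) :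
    ∃ ns : ℕ → ℕ, StrictMono ns ∧
      ∀ x, ∃ c : ℂ, Tendsto (fun k => inner ℂ (v (ns k)) x) atTop (𝓝 c) := by
  -- Sequential Banach–Alaoglu for the functionals `⟨v k, ·⟩`.
  obtain ⟨ℓ, -, ns, hns, hl⟩ := WeakDual.isSeqCompact_closedBall ℂ H (0 : StrongDual ℂ H) B
    (x := fun k => StrongDual.toWeakDual (innerSL ℂ (v k)))
    (fun k => by
      simpa [innerSL_apply_norm] using hv k)
  refine ⟨ns, hns, fun x => ⟨ℓ x, ?_⟩⟩
  exact ((WeakDual.eval_continuous x).tendsto ℓ).comp hl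

/-- A test function as a Schwartz function. -/
def toSchwartz (f : TestFunction Ω ℂ ⊤) : 𝓢(E3, ℂ) :=
  f.hasCompactSupport.toSchwartzMap f.contDiff

theorem toSchwartz_apply (f : TestFunction Ω ℂ ⊤) (x : E3) : toSchwartz f x = f x := rfl

theorem norm_testGraph_fst_sq (f : TestFunction Ω ℂ ⊤) :
    ‖(testGraph Ω f).1‖ ^ 2 = ∫ ξ, ‖𝓕 (toSchwartz f) ξ‖ ^ 2 := by
  rw [SchwartzMap.integral_norm_sq_fourier, ← integral_norm_sq_eq,
    ← setIntegral_eq_integral_of_forall_compl_eq_zero (s := (Ω : Set E3))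
      (f := fun x => ‖toSchwartz f x‖ ^ 2)
      fun x hx => by rw [toSchwartz_apply, testFunction_eq_zero_of_notMem f hx]; simp]
  refine integral_congr_ae ?_
  filter_upwards [(memLp_testFunction f 2 (volume.restrict (Ω : Set E3))).coeFn_toLp] with x hx
  rw [testGraph_fst, hx, toSchwartz_apply]

theorem integrable_norm_sq_schwartz (g : 𝓢(E3, ℂ)) : Integrable fun ξ => ‖g ξ‖ ^ 2 :=
  (memLp_two_iff_integrable_sq_norm g.continuous.aestronglyMeasurable).mp (g.memLp 2 volume)

theorem norm_fourier_lineDeriv_sq (g : 𝓢(E3, ℂ)) (i : Fin 3) (ξ : E3) :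
    ‖𝓕 (∂_{(EuclideanSpace.single i 1 : E3)} g) ξ‖ ^ 2
      = (2 * Real.pi) ^ 2 * (ξ i ^ 2 * ‖𝓕 g ξ‖ ^ 2) := by
  have ht : (inner ℝ · (EuclideanSpace.single i 1 : E3)).HasTemperateGrowth := by fun_prop
  rw [SchwartzMap.fourier_lineDerivOp_eq, smul_apply,
    SchwartzMap.smulLeftCLM_apply_apply ht]
  simp [mul_pow, abs_of_pos Real.pi_pos, EuclideanSpace.inner_single_right]

/-- Plancherel for each partial derivative; the factor `(2π)⁻² ≤ 1` is discarded. -/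
theorem integral_norm_sq_mul_fourier_le (f : TestFunction Ω ℂ ⊤) :
    Integrable (fun ξ => ‖ξ‖ ^ 2 * ‖𝓕 (toSchwartz f) ξ‖ ^ 2) ∧
      ∫ ξ, ‖ξ‖ ^ 2 * ‖𝓕 (toSchwartz f) ξ‖ ^ 2 ≤ ‖(testGraph Ω f).2‖ ^ 2 := by
  set d : Fin 3 → 𝓢(E3, ℂ) := fun i => ∂_{(EuclideanSpace.single i 1 : E3)} (toSchwartz f)
  have hpt : ∀ ξ, ‖ξ‖ ^ 2 * ‖𝓕 (toSchwartz f) ξ‖ ^ 2 =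
      ((2 * Real.pi) ^ 2)⁻¹ * ∑ i, ‖𝓕 (d i) ξ‖ ^ 2 := fun ξ => by
    simp only [d, norm_fourier_lineDeriv_sq]
    rw [← Finset.mul_sum, ← mul_assoc, inv_mul_cancel₀ (by positivity), one_mul,
      ← Finset.sum_mul, EuclideanSpace.real_norm_sq_eq]
  have hi : ∀ i, Integrable fun ξ => ‖𝓕 (d i) ξ‖ ^ 2 := fun i => integrable_norm_sq_schwartz _
  have hg : ‖(testGraph Ω f).2‖ ^ 2 = ∑ i, ∫ x, ‖d i x‖ ^ 2 := by
    rw [← integral_finsetSum _ fun i _ => integrable_norm_sq_schwartz (d i),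
      ← integral_norm_sq_eq,
      ← setIntegral_eq_integral_of_forall_compl_eq_zero (s := (Ω : Set E3))
        (f := fun x => ∑ i, ‖d i x‖ ^ 2)]
    · refine integral_congr_ae ?_
      filter_upwards [(memLp_classicalGradient f 2 (volume.restrict (Ω : Set E3))).coeFn_toLp]
        with x hx
      rw [testGraph_snd, hx, EuclideanSpace.norm_sq_eq]
      rfl
    · intro x hx
      have h := classicalGradient_eq_zero_of_notMem f hx
      refine Finset.sum_eq_zero fun i _ => ?_
      have : d i x = classicalGradient f x i := rfl
      simp [this, h]
  simp_rw [hpt]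
  refine ⟨(integrable_finsetSum _ fun i _ => hi i).const_mul _, ?_⟩
  rw [integral_const_mul, integral_finsetSum _ fun i _ => hi i, hg]
  simp_rw [SchwartzMap.integral_norm_sq_fourier]
  refine mul_le_of_le_one_left (Finset.sum_nonneg fun i _ => integral_nonneg fun x => by positivity)
    (inv_le_one_of_one_le₀ (one_le_pow₀ ?_))
  linarith [Real.pi_gt_three]

/-- Outside the ball of radius `R` one has `1 ≤ R⁻²|ξ|²`, so the gradient controls the high
frequencies. -/
theorem norm_testGraph_fst_sq_le (f : TestFunction Ω ℂ ⊤) {R : ℝ} (hR : 0 < R) :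
    ‖(testGraph Ω f).1‖ ^ 2 ≤
      (∫ ξ in Metric.ball 0 R, ‖𝓕 (toSchwartz f) ξ‖ ^ 2) + (R ^ 2)⁻¹ * ‖(testGraph Ω f).2‖ ^ 2 := by
  obtain ⟨hi, hle⟩ := integral_norm_sq_mul_fourier_le f
  have hi0 := integrable_norm_sq_schwartz (𝓕 (toSchwartz f))
  have hb := hi0.indicator (Metric.isOpen_ball (x := (0 : E3)) (ε := R)).measurableSet
  calc ‖(testGraph Ω f).1‖ ^ 2 = ∫ ξ, ‖𝓕 (toSchwartz f) ξ‖ ^ 2 := norm_testGraph_fst_sq f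
    _ ≤ ∫ ξ, ((Metric.ball (0 : E3) R).indicator (fun ξ => ‖𝓕 (toSchwartz f) ξ‖ ^ 2) ξ +
          (R ^ 2)⁻¹ * (‖ξ‖ ^ 2 * ‖𝓕 (toSchwartz f) ξ‖ ^ 2)) := by
        refine integral_mono hi0 (hb.add (hi.const_mul _)) fun ξ => ?_
        by_cases h : ξ ∈ Metric.ball (0 : E3) R
        · simp only [Set.indicator_of_mem h]
          have : 0 ≤ (R ^ 2)⁻¹ * (‖ξ‖ ^ 2 * ‖𝓕 (toSchwartz f) ξ‖ ^ 2) := by positivity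
          linarith
        · simp only [Set.indicator_of_notMem h, zero_add]
          rw [← mul_assoc]
          refine le_mul_of_one_le_left (by positivity) ?_
          rw [Metric.mem_ball, dist_zero_right, not_lt] at h
          rw [inv_mul_eq_div, one_le_div (by positivity)]
          gcongr
    _ = (∫ ξ in Metric.ball 0 R, ‖𝓕 (toSchwartz f) ξ‖ ^ 2) +
          (R ^ 2)⁻¹ * ∫ ξ, ‖ξ‖ ^ 2 * ‖𝓕 (toSchwartz f) ξ‖ ^ 2 := by
        rw [integral_add hb (hi.const_mul _), integral_const_mul,
          integral_indicator Metric.isOpen_ball.measurableSet]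
    _ ≤ _ := by gcongr

/-- On a bounded `Ω` plane waves are square integrable with norm at most `|Ω|^{1/2}`, uniformly in
`ξ`. Weak `L²` convergence therefore controls the Fourier transform pointwise. The inner product is
the complex conjugate of the transform, hence the norms. -/
theorem exists_planeWave (hΩ : Bornology.IsBounded (Ω : Set E3)) :
    ∃ K : ℝ, ∀ ξ : E3, ∃ e : L2 Ω, ‖e‖ ≤ K ∧
      ∀ f : TestFunction Ω ℂ ⊤, ‖𝓕 (toSchwartz f) ξ‖ = ‖inner ℂ (testGraph Ω f).1 e‖ := by
  have : IsFiniteMeasure (volume.restrict (Ω : Set E3)) :=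
    ⟨by simpa using hΩ.measure_lt_top⟩
  refine ⟨(measureUnivNNReal (volume.restrict (Ω : Set E3))) ^ (2 : ENNReal).toReal⁻¹ * 1,
    fun ξ => ?_⟩
  set c : E3 → ℂ := fun x => Complex.exp (((2 * Real.pi * inner ℝ x ξ : ℝ) : ℂ) * Complex.I)
  have hc : Continuous c := by fun_prop
  have hn : ∀ x, ‖c x‖ = 1 := fun x => Complex.norm_exp_ofReal_mul_I _
  have hm : MemLp c 2 (volume.restrict (Ω : Set E3)) :=
    MemLp.of_bound hc.aestronglyMeasurable 1 (Eventually.of_forall fun x => (hn x).le)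
  refine ⟨hm.toLp c, ?_, fun f => ?_⟩
  · refine Lp.norm_le_of_ae_bound zero_le_one ?_
    filter_upwards [hm.coeFn_toLp] with x hx
    rw [hx, hn]
  · rw [← inner_conj_symm, RCLike.norm_conj, L2.inner_def, SchwartzMap.fourier_coe,
      Real.fourier_eq',
      ← setIntegral_eq_integral_of_forall_compl_eq_zero (s := (Ω : Set E3))
        fun x hx => by rw [toSchwartz_apply, testFunction_eq_zero_of_notMem f hx]; simp]
    congr 1
    refine integral_congr_ae ?_
    filter_upwards [hm.coeFn_toLp,
      (memLp_testFunction f 2 (volume.restrict (Ω : Set E3))).coeFn_toLp] with x hx hx'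
    rw [testGraph_fst, hx, hx', toSchwartz_apply]
    simp only [RCLike.inner_apply, c, ← Complex.exp_conj, smul_eq_mul, map_mul, Complex.conj_ofReal,
      Complex.conj_I]
    rw [mul_comm (f x)]
    congr 2
    push_cast
    ring

theorem exists_cauchy_subseq_testGraph (hΩ : Bornology.IsBounded (Ω : Set E3))
    (f : ℕ → TestFunction Ω ℂ ⊤) {B : ℝ} (hB : ∀ k, ‖testGraph Ω (f k)‖ ≤ B) :
    ∃ ns : ℕ → ℕ, StrictMono ns ∧ CauchySeq fun k => (testGraph Ω (f (ns k))).1 := by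
  have hB1 : ∀ k, ‖(testGraph Ω (f k)).1‖ ≤ B := fun k => (norm_fst_le _).trans (hB k)
  have hB2 : ∀ k, ‖(testGraph Ω (f k)).2‖ ≤ B := fun k => (norm_snd_le _).trans (hB k)
  have hB0 : 0 ≤ B := (norm_nonneg _).trans (hB 0)
  have : Fact ((2 : ENNReal) ≠ ⊤) := ⟨by simp⟩
  obtain ⟨ns, hns, hlim⟩ := exists_subseq_tendsto_inner hB1
  obtain ⟨K, hK⟩ := exists_planeWave hΩ
  choose e he1 he2 using hK
  refine ⟨ns, hns, ?_⟩
  -- Low frequencies: the transforms converge pointwise by weak convergence, and Cauchy–Schwarz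
  -- against the plane wave bounds differences by `(B + B) * K`, so dominated convergence applies on
  -- the ball.
  have hball : ∀ R : ℝ, Tendsto (fun p : ℕ × ℕ => ∫ ξ in Metric.ball 0 R,
      ‖𝓕 (toSchwartz (f (ns p.1) - f (ns p.2))) ξ‖ ^ 2) atTop (𝓝 0) := fun R => by
    have : IsFiniteMeasure ((volume : Measure E3).restrict (Metric.ball 0 R)) :=
      ⟨by simpa using measure_ball_lt_top (μ := (volume : Measure E3)) (x := 0) (r := R)⟩
    have h := tendsto_integral_filter_of_dominated_convergence
      (μ := (volume : Measure E3).restrict (Metric.ball 0 R)) (l := (atTop : Filter (ℕ × ℕ)))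
      (F := fun p ξ => ‖𝓕 (toSchwartz (f (ns p.1) - f (ns p.2))) ξ‖ ^ 2) (f := fun _ => (0 : ℝ))
      (fun _ => ((B + B) * K) ^ 2)
      (Eventually.of_forall fun p => by
        exact ((SchwartzMap.continuous _).norm.pow 2).aestronglyMeasurable)
      (Eventually.of_forall fun p => Eventually.of_forall fun ξ => by
        rw [he2, map_sub, Prod.fst_sub, norm_pow, norm_norm]
        gcongr
        refine (norm_inner_le_norm _ _).trans ?_
        gcongr
        · exact (norm_sub_le _ _).trans (add_le_add (hB1 _) (hB1 _))
        · exact he1 ξ)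
      (integrable_const _)
      (Eventually.of_forall fun ξ => by
        obtain ⟨c, hc⟩ := hlim (e ξ)
        simp_rw [he2, map_sub, Prod.fst_sub, inner_sub_left]
        rw [← prod_atTop_atTop_eq]
        have := (((hc.comp tendsto_fst).sub (hc.comp tendsto_snd)).norm.pow 2 :
          Tendsto _ (atTop ×ˢ atTop) _)
        simpa using this)
    simpa using h
  rw [Metric.cauchySeq_iff']
  intro ε hε
  -- High frequencies: gradients of differences are bounded by `B + B`, so a large `R` makes the
  -- tail at most `ε² / 2`.
  obtain ⟨R, hR0, hR⟩ : ∃ R : ℝ, 0 < R ∧ (R ^ 2)⁻¹ * (B + B) ^ 2 < ε ^ 2 / 2 := by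
    have : Tendsto (fun R : ℝ => (R ^ 2)⁻¹ * (B + B) ^ 2) atTop (𝓝 (0 * (B + B) ^ 2)) :=
      (tendsto_inv_atTop_zero.comp (tendsto_pow_atTop two_ne_zero)).mul_const _
    rw [zero_mul] at this
    exact ((eventually_gt_atTop 0).and (this.eventually_lt_const (by positivity))).exists
  have hev := (hball R).eventually_lt_const (show (0 : ℝ) < ε ^ 2 / 2 by positivity)
  obtain ⟨⟨a, b⟩, hab⟩ := eventually_atTop.mp hev
  refine ⟨max a b, fun n hn => ?_⟩
  have h1 := hab (n, max a b) ⟨(le_max_left _ _).trans hn, le_max_right _ _⟩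
  have h2 := norm_testGraph_fst_sq_le (f (ns n) - f (ns (max a b))) hR0
  have h3 : ‖(testGraph Ω (f (ns n) - f (ns (max a b)))).2‖ ≤ B + B := by
    rw [map_sub, Prod.snd_sub]
    exact (norm_sub_le _ _).trans (add_le_add (hB2 _) (hB2 _))
  have h4 : (R ^ 2)⁻¹ * ‖(testGraph Ω (f (ns n) - f (ns (max a b)))).2‖ ^ 2 ≤
      (R ^ 2)⁻¹ * (B + B) ^ 2 := by gcongr
  rw [dist_eq_norm, ← Prod.fst_sub, ← map_sub]
  refine lt_of_pow_lt_pow_left₀ 2 hε.le ?_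
  simp only at h1
  linarith

/-- **Rellich compactness**: on a bounded open set, sequences bounded in `H¹₀` have subsequences
that converge in `L²`. -/
theorem exists_cauchy_subseq_of_mem_sobolevGraph (hΩ : Bornology.IsBounded (Ω : Set E3))
    {w : ℕ → L2 Ω × L2Vec Ω} (hw : ∀ k, w k ∈ sobolevGraph Ω) {B : ℝ} (hB : ∀ k, ‖w k‖ ≤ B) :
    ∃ ns : ℕ → ℕ, StrictMono ns ∧ CauchySeq fun k => (w (ns k)).1 := by
  -- Test functions at distance below `1 / (k + 1)` from `w k` have the same `L²` limits along
  -- subsequences.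
  have happ : ∀ k, ∃ f : TestFunction Ω ℂ ⊤, dist (testGraph Ω f) (w k) < 1 / ((k : ℝ) + 1) :=
    fun k => by
      obtain ⟨f, hf⟩ := exists_seq_of_mem_sobolevGraph (hw k)
      obtain ⟨j, hj⟩ := (Metric.tendsto_nhds.mp hf (1 / ((k : ℝ) + 1)) (by positivity)).exists
      exact ⟨f j, hj⟩
  choose f hf using happ
  have hfB : ∀ k, ‖testGraph Ω (f k)‖ ≤ B + 1 := fun k => by
    have h1 : 1 / ((k : ℝ) + 1) ≤ 1 := by
      rw [div_le_one (by positivity)]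
      linarith [(Nat.cast_nonneg k : (0 : ℝ) ≤ k)]
    have h2 := norm_le_norm_add_norm_sub (w k) (testGraph Ω (f k))
    rw [norm_sub_rev, ← dist_eq_norm] at h2
    linarith [hB k, hf k]
  obtain ⟨ns, hns, hc⟩ := exists_cauchy_subseq_testGraph hΩ f hfB
  refine ⟨ns, hns, ?_⟩
  obtain ⟨u, hu⟩ := cauchySeq_tendsto_of_complete hc
  have hd : Tendsto (fun k => dist (testGraph Ω (f (ns k))).1 (w (ns k)).1) atTop (𝓝 0) :=
    squeeze_zero (fun _ => dist_nonneg)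
      (fun k => (le_max_left _ _).trans (hf (ns k)).le)
      (tendsto_one_div_add_atTop_nhds_zero_nat.comp hns.tendsto_atTop)
  exact ((tendsto_iff_of_dist hd).mp hu).cauchySeq

end Rellich

/-! ### The three potentials lie in `L^{3/2}(Ω)` -/

section Potentials

variable {Ω : TopologicalSpace.Opens E3}

theorem isFiniteMeasure_restrict_of_isBounded (hΩ : Bornology.IsBounded (Ω : Set E3)) :
    IsFiniteMeasure ((volume : Measure E3).restrict (Ω : Set E3)) :=
  ⟨by simpa using hΩ.measure_lt_top⟩

theorem lintegral_ball_inv_norm_sq_lt_top :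
    ∫⁻ x in Metric.ball (0 : E3) 1, ‖1 / ‖x‖‖ₑ ^ 2 < ⊤ := by
  have h : IntegrableOn (fun x : E3 => (1 / ‖x‖) ^ 2) (Metric.ball 0 1) := by
    refine integrableOn_ball_of_norm_le_rpow (C := 1) (α := 2) (by simp) (by simp; norm_num)
      (Eventually.of_forall fun x => ?_) (by fun_prop : Measurable _).aestronglyMeasurable
    rw [Real.rpow_neg (norm_nonneg _)]
    simp
  have h2 := h.2
  simp only [HasFiniteIntegral, enorm_pow] at h2
  exact h2

/-- The squared kernel is at most `1` away from its singularity and integrable near it, as `2 < 3`.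
Translation invariance makes the bound uniform in `y`. -/
theorem exists_lintegral_inv_norm_sub_sq_le (hΩ : Bornology.IsBounded (Ω : Set E3)) :
    ∃ C : ENNReal, C < ⊤ ∧ ∀ y : E3, ∫⁻ x in (Ω : Set E3), ‖1 / ‖x - y‖‖ₑ ^ 2 ≤ C := by
  have := isFiniteMeasure_restrict_of_isBounded hΩ
  set k : E3 → ENNReal := fun x => ‖1 / ‖x‖‖ₑ ^ 2
  refine ⟨(∫⁻ x in Metric.ball (0 : E3) 1, k x) + volume (Ω : Set E3),
    ENNReal.add_lt_top.mpr ⟨lintegral_ball_inv_norm_sq_lt_top, hΩ.measure_lt_top⟩, fun y => ?_⟩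
  have hk : Measurable k := by fun_prop
  have hpt : ∀ x, k x ≤ (Metric.ball (0 : E3) 1).indicator k x + 1 := fun x => by
    by_cases h : x ∈ Metric.ball (0 : E3) 1
    · rw [Set.indicator_of_mem h]
      exact le_self_add
    · rw [Set.indicator_of_notMem h, zero_add]
      rw [Metric.mem_ball, dist_zero_right, not_lt] at h
      refine pow_le_one' ?_ 2
      rw [Real.enorm_of_nonneg (by positivity), ENNReal.ofReal_le_one]
      exact div_le_one_of_le₀ h (norm_nonneg _)
  calc ∫⁻ x in (Ω : Set E3), k (x - y)
      ≤ ∫⁻ x in (Ω : Set E3), ((Metric.ball (0 : E3) 1).indicator k (x - y) + 1) :=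
        lintegral_mono fun x => hpt _
    _ = (∫⁻ x in (Ω : Set E3), (Metric.ball (0 : E3) 1).indicator k (x - y)) +
          volume (Ω : Set E3) := by
        rw [lintegral_add_right _ measurable_const]
        simp
    _ ≤ (∫⁻ x, (Metric.ball (0 : E3) 1).indicator k (x - y)) + volume (Ω : Set E3) := by
        gcongr
        exact Measure.restrict_le_self
    _ = _ := by
        rw [lintegral_sub_right_eq_self (fun x => (Metric.ball (0 : E3) 1).indicator k x) y,
          lintegral_indicator Metric.isOpen_ball.measurableSet]

theorem sq_lintegral_le {α : Type*} [MeasurableSpace α] (ν : Measure α) {f : α → ENNReal}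
    (hf : AEMeasurable f ν) : (∫⁻ y, f y ∂ν) ^ 2 ≤ ν Set.univ * ∫⁻ y, f y ^ 2 ∂ν := by
  have h := ENNReal.lintegral_mul_le_Lp_mul_Lq ν Real.HolderConjugate.two_two
    (aemeasurable_const (b := (1 : ENNReal))) hf
  simp only [Pi.mul_apply, one_mul, ENNReal.one_rpow, lintegral_const] at h
  calc (∫⁻ y, f y ∂ν) ^ 2 ≤ _ := pow_le_pow_left' h 2
    _ = ν Set.univ * ∫⁻ y, f y ^ 2 ∂ν := by
      rw [mul_pow]
      simp_rw [← ENNReal.rpow_natCast, ← ENNReal.rpow_mul]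
      simp

theorem measurable_inv_norm_sub : Measurable fun z : E3 × E3 => 1 / ‖z.1 - z.2‖ := by
  fun_prop

/-- Cauchy–Schwarz in `y`, Tonelli, then the uniform kernel bound in `x`. -/
theorem lintegral_sq_potential_lt_top (hΩ : Bornology.IsBounded (Ω : Set E3)) (ν : Measure E3)
    [IsFiniteMeasure ν] :
    ∫⁻ x in (Ω : Set E3), (∫⁻ y, ‖1 / ‖x - y‖‖ₑ ∂ν) ^ 2 < ⊤ := by
  obtain ⟨C, hC, hle⟩ := exists_lintegral_inv_norm_sub_sq_le hΩ
  have hm : Measurable fun z : E3 × E3 => ‖1 / ‖z.1 - z.2‖‖ₑ := measurable_inv_norm_sub.enorm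
  calc ∫⁻ x in (Ω : Set E3), (∫⁻ y, ‖1 / ‖x - y‖‖ₑ ∂ν) ^ 2
      ≤ ∫⁻ x in (Ω : Set E3), ν Set.univ * ∫⁻ y, ‖1 / ‖x - y‖‖ₑ ^ 2 ∂ν :=
        lintegral_mono fun x => sq_lintegral_le ν (hm.comp measurable_prodMk_left).aemeasurable
    _ = ν Set.univ * ∫⁻ x in (Ω : Set E3), ∫⁻ y, ‖1 / ‖x - y‖‖ₑ ^ 2 ∂ν :=
        lintegral_const_mul' _ _ (measure_ne_top _ _)
    _ = ν Set.univ * ∫⁻ y, (∫⁻ x in (Ω : Set E3), ‖1 / ‖x - y‖‖ₑ ^ 2) ∂ν := by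
        rw [lintegral_lintegral_swap (hm.pow_const 2).aemeasurable]
    _ ≤ ν Set.univ * ∫⁻ _, C ∂ν := by
        gcongr with y
        exact hle y
    _ < ⊤ := by
        rw [lintegral_const]
        exact ENNReal.mul_lt_top (measure_lt_top _ _) (ENNReal.mul_lt_top hC (measure_lt_top _ _))

theorem ae_integrable_inv_norm_sub (hΩ : Bornology.IsBounded (Ω : Set E3)) (ν : Measure E3)
    [IsFiniteMeasure ν] :
    ∀ᵐ x ∂(volume.restrict (Ω : Set E3)), Integrable (fun y => 1 / ‖x - y‖) ν := by
  have hm : Measurable fun z : E3 × E3 => ‖1 / ‖z.1 - z.2‖‖ₑ := measurable_inv_norm_sub.enorm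
  filter_upwards [ae_lt_top (hm.lintegral_prod_right'.pow_const 2)
    (lintegral_sq_potential_lt_top hΩ ν).ne] with x hx
  exact ⟨(measurable_inv_norm_sub.comp measurable_prodMk_left).aestronglyMeasurable,
    (ENNReal.pow_lt_top_iff.mp hx).resolve_right two_ne_zero⟩

theorem memLp_potential (hΩ : Bornology.IsBounded (Ω : Set E3)) (ν : Measure E3)
    [IsFiniteMeasure ν] :
    MemLp (fun x => ∫ y, 1 / ‖x - y‖ ∂ν) (3 / 2) (volume.restrict (Ω : Set E3)) := by
  have := isFiniteMeasure_restrict_of_isBounded hΩ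
  have h2 : MemLp (fun x => ∫ y, 1 / ‖x - y‖ ∂ν) 2 (volume.restrict (Ω : Set E3)) := by
    refine ⟨(measurable_inv_norm_sub.stronglyMeasurable.integral_prod_right').aestronglyMeasurable,
      ?_⟩
    rw [eLpNorm_lt_top_iff_lintegral_rpow_enorm_lt_top (by norm_num) (by norm_num)]
    refine lt_of_le_of_lt (lintegral_mono fun x => ?_) (lintegral_sq_potential_lt_top hΩ ν)
    simp only [ENNReal.toReal_ofNat, ENNReal.rpow_ofNat]
    gcongr
    exact enorm_integral_le_lintegral_enorm _
  refine h2.mono_exponent ?_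
  rw [ENNReal.div_le_iff (by simp) (by simp)]
  norm_num

theorem measurable_density {n : ℕ} (φ : Fin n → L2 Ω) : Measurable (density φ) := by
  have h : ∀ i, Measurable (φ i) := fun i => (Lp.stronglyMeasurable (φ i)).measurable
  unfold density
  fun_prop

theorem density_nonneg {n : ℕ} (φ : Fin n → L2 Ω) (x : E3) : 0 ≤ density φ x := by
  unfold density
  positivity

theorem integrable_density {n : ℕ} (φ : Fin n → L2 Ω) :
    Integrable (density φ) (volume.restrict (Ω : Set E3)) := by
  refine (integrable_finsetSum _ fun i _ => ?_).const_mul 2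
  exact (memLp_two_iff_integrable_sq_norm (Lp.aestronglyMeasurable _)).mp (Lp.memLp (φ i))

/-- The measure `ρ dx` on `Ω`. -/
def densityMeasure {n : ℕ} (φ : Fin n → L2 Ω) : Measure E3 :=
  (volume.restrict (Ω : Set E3)).withDensity fun x => ENNReal.ofReal (density φ x)

instance isFiniteMeasure_densityMeasure {n : ℕ} (φ : Fin n → L2 Ω) :
    IsFiniteMeasure (densityMeasure φ) :=
  isFiniteMeasure_withDensity_ofReal (integrable_density φ).2

/-- Makes the Hartree term the potential of a finite measure, so it is handled exactly like the
nuclear one. -/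
theorem vH_eq_integral_densityMeasure {n : ℕ} (φ : Fin n → L2 Ω) (x : E3) :
    vH φ x = ∫ y, 1 / ‖x - y‖ ∂(densityMeasure φ) := by
  rw [densityMeasure, integral_withDensity_eq_integral_toReal_smul
    (measurable_density φ).ennreal_ofReal (by simp)]
  simp [vH, ENNReal.toReal_ofReal (density_nonneg φ _), div_eq_mul_inv]

theorem ae_integrableOn_density_div (hΩ : Bornology.IsBounded (Ω : Set E3)) {n : ℕ}
    (φ : Fin n → L2 Ω) : ∀ᵐ x ∂(volume.restrict (Ω : Set E3)),
      IntegrableOn (fun y => density φ y / ‖x - y‖) (Ω : Set E3) := by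
  filter_upwards [ae_integrable_inv_norm_sub hΩ (densityMeasure φ)] with x hx
  rw [densityMeasure, integrable_withDensity_iff_integrable_smul'
    (measurable_density φ).ennreal_ofReal (by simp)] at hx
  simpa [IntegrableOn, ENNReal.toReal_ofReal (density_nonneg φ _), div_eq_mul_inv] using hx

theorem memLp_vH (hΩ : Bornology.IsBounded (Ω : Set E3)) {n : ℕ} (φ : Fin n → L2 Ω) :
    MemLp (vH φ) (3 / 2) (volume.restrict (Ω : Set E3)) := by
  rw [funext (vH_eq_integral_densityMeasure φ)]
  exact memLp_potential hΩ _

theorem isFiniteMeasure_of_mem_nuclearMeasures {Ωnuc : Set E3} {n : ℕ} {μ : Measure E3}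
    (hμ : μ ∈ nuclearMeasures Ωnuc n) : IsFiniteMeasure μ := by
  refine ⟨?_⟩
  rw [← Set.union_compl_self Ωnuc]
  refine (measure_union_le _ _).trans_lt ?_
  rw [hμ.1, hμ.2, add_zero]
  exact ENNReal.mul_lt_top (by simp) (by simp)

theorem memLp_vext (hΩ : Bornology.IsBounded (Ω : Set E3)) (Ωnuc : Set E3) (μ : Measure E3)
    [IsFiniteMeasure μ] : MemLp (vext Ωnuc μ) (3 / 2) (volume.restrict (Ω : Set E3)) :=
  (memLp_potential hΩ (μ.restrict Ωnuc)).neg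

/-- As `ρ ∈ L¹`, the power `ρ^{2/3}` is in `L^{3/2}`; the condition `p < 5/3` lets `1 + ρ^{2/3}`
dominate `ρ^{p-1}`. -/
theorem memLp_vxc (hΩ : Bornology.IsBounded (Ω : Set E3)) {exc : ℝ → ℝ} (hexc : AdmissibleXC exc)
    {n : ℕ} (φ : Fin n → L2 Ω) :
    MemLp (fun x => vxc exc (density φ x)) (3 / 2) (volume.restrict (Ω : Set E3)) := by
  have := isFiniteMeasure_restrict_of_isBounded hΩ
  obtain ⟨hC1, p, c, hp1, hp, hb⟩ := hexc
  -- Precomposing with `max r 0` gives a continuous function on all of `ℝ`, which yields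
  -- measurability and changes nothing at `ρ ≥ 0`.
  have hcont : Continuous fun r => vxc exc (max r 0) :=
    (hC1.continuousOn_derivWithin (uniqueDiffOn_Ici 0) le_rfl).comp_continuous
      (by fun_prop) fun r => Set.mem_Ici.mpr (le_max_right r 0)
  have hmeas : Measurable fun x => vxc exc (density φ x) := by
    have h := hcont.measurable.comp (measurable_density φ)
    simpa [Function.comp_def, density_nonneg] using h
  have hρ : MemLp (fun x => density φ x ^ (2 / 3 : ℝ)) (3 / 2)
      (volume.restrict (Ω : Set E3)) := by
    have h := (memLp_one_iff_integrable.mpr (integrable_density φ)).norm_rpow_div (2 / 3)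
    rw [one_div, ENNReal.inv_div (by simp) (by simp)] at h
    simpa [abs_of_nonneg (density_nonneg φ _)] using h
  refine (((memLp_const (2 : ℝ)).add hρ).const_mul |c|).mono' hmeas.aestronglyMeasurable
    (Eventually.of_forall fun x => ?_)
  have hx := density_nonneg φ x
  refine (hb _ hx).2.trans ?_
  have h1 : density φ x ^ (p - 1) ≤ 1 + density φ x ^ (2 / 3 : ℝ) := by
    have h3 : 0 ≤ density φ x ^ (2 / 3 : ℝ) := Real.rpow_nonneg hx _
    rcases le_total (density φ x) 1 with h | h
    · linarith [Real.rpow_le_one hx h (sub_nonneg.mpr hp1)]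
    · linarith [Real.rpow_le_rpow_of_exponent_le h (by linarith : p - 1 ≤ 2 / 3)]
  have h0 : 0 ≤ density φ x ^ (p - 1) := Real.rpow_nonneg hx _
  have h2 : c * (1 + density φ x ^ (p - 1)) ≤ |c| * (1 + density φ x ^ (p - 1)) := by
    gcongr
    exact le_abs_self c
  refine h2.trans ?_
  exact mul_le_mul_of_nonneg_left (by simp only [Pi.add_apply]; linarith) (abs_nonneg c)

end Potentials

/-! ### The energy form and its minimization -/

section Minimization

variable {Ω : TopologicalSpace.Opens E3} {V : E3 → ℝ}

/-- The quadratic form `∫_Ω V |u|²`. -/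
def potentialForm (V : E3 → ℝ) (w : L2 Ω × L2Vec Ω) : ℝ :=
  ∫ x in (Ω : Set E3), V x * ‖w.1 x‖ ^ 2

/-- The quadratic form `½ ∫_Ω |g|² + ∫_Ω V |u|²`. -/
def energyForm (V : E3 → ℝ) (w : L2 Ω × L2Vec Ω) : ℝ :=
  1 / 2 * ‖w.2‖ ^ 2 + potentialForm V w

theorem potentialForm_parallelogram
    (hV : MemLp V (3 / 2) (volume.restrict (Ω : Set E3))) {w z : L2 Ω × L2Vec Ω}
    (hw : w ∈ sobolevGraph Ω) (hz : z ∈ sobolevGraph Ω) :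
    potentialForm V (w + z) + potentialForm V (w - z) =
      2 * potentialForm V w + 2 * potentialForm V z := by
  have iw := integrable_potential_mul_norm_sq hV hw
  have iz := integrable_potential_mul_norm_sq hV hz
  unfold potentialForm
  rw [← integral_add (integrable_potential_mul_norm_sq hV (add_mem hw hz))
    (integrable_potential_mul_norm_sq hV (sub_mem hw hz)), ← integral_const_mul,
    ← integral_const_mul, ← integral_add (iw.const_mul 2) (iz.const_mul 2)]
  refine integral_congr_ae ?_
  filter_upwards [Lp.coeFn_add w.1 z.1, Lp.coeFn_sub w.1 z.1] with x h1 h2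
  rw [Prod.fst_add, Prod.fst_sub, h1, h2, Pi.add_apply, Pi.sub_apply]
  have h := parallelogram_law_with_norm ℝ (w.1 x) (z.1 x)
  rw [← mul_add, h]
  ring

theorem potentialForm_smul (c : ℂ) (w : L2 Ω × L2Vec Ω) :
    potentialForm V (c • w) = ‖c‖ ^ 2 * potentialForm V w := by
  unfold potentialForm
  rw [← integral_const_mul]
  refine integral_congr_ae ?_
  filter_upwards [Lp.coeFn_smul c w.1] with x h
  rw [Prod.smul_fst, h, Pi.smul_apply, norm_smul, mul_pow]
  ring

/-- The difference of squares is the real inner product of `a - b` and `a + b`; then Cauchy–Schwarz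
and weighted AM–GM. -/
theorem abs_sub_norm_sq_le (a b : ℂ) {t : ℝ} (ht : 0 < t) :
    |‖a‖ ^ 2 - ‖b‖ ^ 2| ≤ (t⁻¹ * ‖a - b‖ ^ 2 + t * ‖a + b‖ ^ 2) / 2 := by
  have h1 : |‖a‖ - ‖b‖| ≤ ‖a - b‖ := abs_norm_sub_norm_le a b
  have h2 : ‖a‖ ^ 2 - ‖b‖ ^ 2 = inner ℝ (a - b) (a + b) := by
    rw [inner_add_right, inner_sub_left, inner_sub_left, real_inner_self_eq_norm_sq,
      real_inner_self_eq_norm_sq, real_inner_comm b a]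
    ring
  rw [h2]
  refine (abs_real_inner_le_norm _ _).trans ?_
  have h3 : t⁻¹ * ‖a - b‖ ^ 2 + t * ‖a + b‖ ^ 2 - 2 * (‖a - b‖ * ‖a + b‖) =
      t⁻¹ * (‖a - b‖ - t * ‖a + b‖) ^ 2 := by
    field_simp
    ring
  have h4 : 0 ≤ t⁻¹ * (‖a - b‖ - t * ‖a + b‖) ^ 2 := by positivity
  linarith

theorem exists_abs_potentialForm_sub_le
    (hV : MemLp V (3 / 2) (volume.restrict (Ω : Set E3))) :
    ∃ C : ℝ, ∀ w ∈ sobolevGraph Ω, ∀ z ∈ sobolevGraph Ω,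
      |potentialForm V w - potentialForm V z| ≤ C * (‖w - z‖ * (1 + ‖w + z‖ ^ 2)) := by
  obtain ⟨C, hC0, hC⟩ := exists_form_bound hV one_pos
  have hb : ∀ w ∈ sobolevGraph Ω,
      ∫ x in (Ω : Set E3), |V x| * ‖w.1 x‖ ^ 2 ≤ (1 + C) * ‖w‖ ^ 2 := fun w hw => by
    refine (hC w hw).trans ?_
    rw [add_mul]
    gcongr
    · exact norm_snd_le w
    · exact norm_fst_le w
  refine ⟨(1 + C) / 2, fun w hw z hz => ?_⟩
  rcases eq_or_ne w z with rfl | hne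
  · simp
  have ht : 0 < ‖w - z‖ := norm_pos_iff.mpr (sub_ne_zero.mpr hne)
  -- This weight turns `t⁻¹‖w - z‖²` into `t`, so both terms carry the factor `‖w - z‖`.
  set t := ‖w - z‖
  have hp := add_mem hw hz
  have hm := sub_mem hw hz
  have ia : ∀ y ∈ sobolevGraph Ω, IntegrableOn (fun x => |V x| * ‖y.1 x‖ ^ 2) (Ω : Set E3) :=
    fun y hy => by simpa [abs_mul, IntegrableOn] using (integrable_potential_mul_norm_sq hV hy).abs
  calc |potentialForm V w - potentialForm V z|
      = |∫ x in (Ω : Set E3), (V x * ‖w.1 x‖ ^ 2 - V x * ‖z.1 x‖ ^ 2)| := by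
        rw [integral_sub (integrable_potential_mul_norm_sq hV hw)
          (integrable_potential_mul_norm_sq hV hz)]
        rfl
    _ ≤ ∫ x in (Ω : Set E3), |V x * ‖w.1 x‖ ^ 2 - V x * ‖z.1 x‖ ^ 2| :=
        abs_integral_le_integral_abs
    _ ≤ ∫ x in (Ω : Set E3), (t⁻¹ / 2 * (|V x| * ‖(w - z).1 x‖ ^ 2) +
          t / 2 * (|V x| * ‖(w + z).1 x‖ ^ 2)) := by
        refine integral_mono_ae ((integrable_potential_mul_norm_sq hV hw).sub
          (integrable_potential_mul_norm_sq hV hz)).abs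
          (((ia _ hm).const_mul _).add ((ia _ hp).const_mul _)) ?_
        filter_upwards [Lp.coeFn_add w.1 z.1, Lp.coeFn_sub w.1 z.1] with x h1 h2
        rw [Prod.fst_add, Prod.fst_sub, h1, h2, Pi.add_apply, Pi.sub_apply, ← mul_sub, abs_mul]
        have h := mul_le_mul_of_nonneg_left (abs_sub_norm_sq_le (w.1 x) (z.1 x) ht)
          (abs_nonneg (V x))
        linarith
    _ = t⁻¹ / 2 * (∫ x in (Ω : Set E3), |V x| * ‖(w - z).1 x‖ ^ 2) +
          t / 2 * ∫ x in (Ω : Set E3), |V x| * ‖(w + z).1 x‖ ^ 2 := by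
        rw [integral_add ((ia _ hm).const_mul _) ((ia _ hp).const_mul _), integral_const_mul,
          integral_const_mul]
    _ ≤ t⁻¹ / 2 * ((1 + C) * t ^ 2) + t / 2 * ((1 + C) * ‖w + z‖ ^ 2) := by
        gcongr
        · exact hb _ hm
        · exact hb _ hp
    _ = (1 + C) / 2 * (t * (1 + ‖w + z‖ ^ 2)) := by
        field_simp

theorem continuous_potentialForm (hV : MemLp V (3 / 2) (volume.restrict (Ω : Set E3))) :
    Continuous fun w : sobolevGraph Ω => potentialForm V (w : L2 Ω × L2Vec Ω) := by
  obtain ⟨C, hC⟩ := exists_abs_potentialForm_sub_le hV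
  refine continuous_iff_continuousAt.mpr fun z => ?_
  rw [ContinuousAt, tendsto_iff_dist_tendsto_zero]
  refine squeeze_zero (fun _ => dist_nonneg) (fun w => hC w w.2 z z.2) ?_
  have h : Continuous fun w : sobolevGraph Ω =>
      C * (‖(w : L2 Ω × L2Vec Ω) - z‖ * (1 + ‖(w : L2 Ω × L2Vec Ω) + z‖ ^ 2)) := by
    fun_prop
  simpa using h.tendsto z

theorem continuous_energyForm (hV : MemLp V (3 / 2) (volume.restrict (Ω : Set E3))) :
    Continuous fun w : sobolevGraph Ω => energyForm V (w : L2 Ω × L2Vec Ω) := by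
  have := continuous_potentialForm hV
  unfold energyForm
  fun_prop

theorem energyForm_parallelogram
    (hV : MemLp V (3 / 2) (volume.restrict (Ω : Set E3))) {w z : L2 Ω × L2Vec Ω}
    (hw : w ∈ sobolevGraph Ω) (hz : z ∈ sobolevGraph Ω) :
    energyForm V (w + z) + energyForm V (w - z) = 2 * energyForm V w + 2 * energyForm V z := by
  have h1 := potentialForm_parallelogram hV hw hz
  have h2 := parallelogram_law_with_norm ℂ w.2 z.2
  simp only [energyForm, Prod.snd_add, Prod.snd_sub]
  linarith

theorem energyForm_smul (c : ℂ) (w : L2 Ω × L2Vec Ω) :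
    energyForm V (c • w) = ‖c‖ ^ 2 * energyForm V w := by
  rw [energyForm, energyForm, potentialForm_smul, Prod.smul_snd, norm_smul]
  ring

theorem exists_energyForm_lower_bound
    (hV : MemLp V (3 / 2) (volume.restrict (Ω : Set E3))) :
    ∃ C : ℝ, 0 ≤ C ∧ ∀ w ∈ sobolevGraph Ω,
      1 / 4 * ‖w.2‖ ^ 2 - C * ‖w.1‖ ^ 2 ≤ energyForm V w := by
  obtain ⟨C, hC0, hC⟩ := exists_form_bound hV (ε := 1 / 4) (by norm_num)
  refine ⟨C, hC0, fun w hw => ?_⟩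
  have h : |potentialForm V w| ≤ ∫ x in (Ω : Set E3), |V x| * ‖w.1 x‖ ^ 2 := by
    refine abs_integral_le_integral_abs.trans_eq ?_
    simp [abs_mul]
  have h1 := hC w hw
  have h2 := neg_abs_le (potentialForm V w)
  unfold energyForm
  linarith

/-- Uniqueness of weak gradients: the first component determines the second. -/
theorem eq_zero_of_mem_sobolevGraph {w : L2 Ω × L2Vec Ω} (hw : w ∈ sobolevGraph Ω)
    (h : w.1 = 0) : w = 0 := by
  have h1 := weakGradient_eq_of_mem_sobolevGraph hw
  have h2 := weakGradient_eq_of_mem_sobolevGraph (zero_mem (sobolevGraph Ω))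
  rw [h] at h1
  exact Prod.ext h (h1.symm.trans h2)

/-- The energy form attains its minimum over the unit vectors of a closed subspace. -/
theorem exists_isMinOn_energyForm (hΩ : Bornology.IsBounded (Ω : Set E3))
    (hV : MemLp V (3 / 2) (volume.restrict (Ω : Set E3))) (K : Submodule ℂ (L2 Ω))
    (hK : IsClosed (K : Set (L2 Ω)))
    (hne : {w : L2 Ω × L2Vec Ω | w ∈ sobolevGraph Ω ∧ w.1 ∈ K ∧ ‖w.1‖ = 1}.Nonempty) :
    ∃ w₀ ∈ {w : L2 Ω × L2Vec Ω | w ∈ sobolevGraph Ω ∧ w.1 ∈ K ∧ ‖w.1‖ = 1},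
      IsMinOn (energyForm V) {w | w ∈ sobolevGraph Ω ∧ w.1 ∈ K ∧ ‖w.1‖ = 1} w₀ := by
  set S := {w : L2 Ω × L2Vec Ω | w ∈ sobolevGraph Ω ∧ w.1 ∈ K ∧ ‖w.1‖ = 1}
  obtain ⟨C, hC0, hC⟩ := exists_energyForm_lower_bound hV
  have hbdd : BddBelow (energyForm V '' S) := by
    refine ⟨-C, ?_⟩
    rintro _ ⟨w, ⟨hw, -, hw1⟩, rfl⟩
    have h := hC w hw
    rw [hw1] at h
    linarith [sq_nonneg ‖w.2‖]
  set m := sInf (energyForm V '' S)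
  have hm : ∀ w ∈ S, m ≤ energyForm V w := fun w hw => csInf_le hbdd ⟨w, hw, rfl⟩
  -- Homogeneity extends the bound by `m` to vectors that are not normalized, such as sums of
  -- members of the minimizing sequence.
  have hmK : ∀ z ∈ sobolevGraph Ω, z.1 ∈ K → m * ‖z.1‖ ^ 2 ≤ energyForm V z := by
    intro z hz hzK
    by_cases h0 : z.1 = 0
    · rw [eq_zero_of_mem_sobolevGraph hz h0]
      have := energyForm_smul (V := V) 0 z
      simp only [zero_smul, norm_zero] at this
      simp [this]
    · have hpos : 0 < ‖z.1‖ := norm_pos_iff.mpr h0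
      have h := hm (((‖z.1‖⁻¹ : ℝ) : ℂ) • z) ⟨Submodule.smul_mem _ _ hz,
        Submodule.smul_mem _ _ hzK, by
          rw [Prod.smul_fst, norm_smul, Complex.norm_real, norm_inv, norm_norm,
            inv_mul_cancel₀ hpos.ne']⟩
      rw [energyForm_smul, Complex.norm_real, norm_inv, norm_norm, inv_pow, inv_mul_eq_div,
        le_div_iff₀ (by positivity)] at h
      exact h
  obtain ⟨e, -, helim, hemem⟩ := exists_seq_tendsto_sInf (hne.image (energyForm V)) hbdd
  choose w hwS hwe using hemem
  obtain ⟨B, hB⟩ := helim.bddAbove_range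
  have hwB : ∀ k, ‖w k‖ ≤ 1 + 4 * (|B| + C) := fun k => by
    have h1 := hC (w k) (hwS k).1
    rw [(hwS k).2.2, hwe] at h1
    have h2 : e k ≤ B := hB ⟨k, rfl⟩
    have h3 := le_abs_self B
    refine max_le ?_ ?_
    · rw [(hwS k).2.2]
      linarith [abs_nonneg B]
    · nlinarith [sq_nonneg (‖(w k).2‖ - 1), norm_nonneg (w k).2, abs_nonneg B]
  obtain ⟨ns, hns, hcau⟩ := exists_cauchy_subseq_of_mem_sobolevGraph hΩ (fun k => (hwS k).1) hwB
  obtain ⟨v, hv⟩ : ∃ v : ℕ → L2 Ω × L2Vec Ω, v = fun k => w (ns k) := ⟨_, rfl⟩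
  replace hcau : CauchySeq fun k => (v k).1 := by rwa [hv]
  have hvS : ∀ k, v k ∈ S := fun k => by rw [hv]; exact hwS _
  have hve : Tendsto (fun k => energyForm V (v k)) atTop (𝓝 m) := by
    simpa [hv, hwe, Function.comp_def] using helim.comp hns.tendsto_atTop
  -- In the parallelogram identity for the energy, the sum is bounded below by `m` times its squared
  -- norm `4 - ‖u_k - u_l‖²`, and the difference by coercivity. What remains bounds the gradient
  -- difference by energy excesses and an `L²` distance, all tending to zero.
  have hkey : ∀ k l, ‖(v k).2 - (v l).2‖ ^ 2 ≤ 4 * (2 * (energyForm V (v k) - m) +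
      2 * (energyForm V (v l) - m) + (m + C) * ‖(v k).1 - (v l).1‖ ^ 2) := fun k l => by
    have h1 := energyForm_parallelogram hV (hvS k).1 (hvS l).1
    have h2 := hmK _ (add_mem (hvS k).1 (hvS l).1) (K.add_mem (hvS k).2.1 (hvS l).2.1)
    have h3 := hC _ (sub_mem (hvS k).1 (hvS l).1)
    have h4 := parallelogram_law_with_norm ℂ (v k).1 (v l).1
    rw [(hvS k).2.2, (hvS l).2.2] at h4
    have h5 : ‖(v k + v l).1‖ ^ 2 = 4 - ‖(v k).1 - (v l).1‖ ^ 2 := by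
      rw [Prod.fst_add]
      linarith
    rw [h5] at h2
    rw [Prod.fst_sub, Prod.snd_sub] at h3
    linarith
  have hcau2 : CauchySeq fun k => (v k).2 := by
    rw [cauchySeq_iff_tendsto_dist_atTop_0]
    have hd := cauchySeq_iff_tendsto_dist_atTop_0.mp hcau
    have h0 : Tendsto (fun k => energyForm V (v k) - m) atTop (𝓝 0) := by
      simpa using hve.sub_const m
    have h1 : Tendsto (fun p : ℕ × ℕ => energyForm V (v p.1) - m) atTop (𝓝 0) := by
      rw [← prod_atTop_atTop_eq]
      exact h0.comp tendsto_fst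
    have h2 : Tendsto (fun p : ℕ × ℕ => energyForm V (v p.2) - m) atTop (𝓝 0) := by
      rw [← prod_atTop_atTop_eq]
      exact h0.comp tendsto_snd
    have h3 := (((h1.const_mul 2).add (h2.const_mul 2)).add
      ((hd.pow 2).const_mul (m + C))).const_mul 4
    simp only [mul_zero, add_zero, ne_eq, OfNat.ofNat_ne_zero, not_false_eq_true, zero_pow] at h3
    have h4 : Tendsto (fun p : ℕ × ℕ => dist (v p.1).2 (v p.2).2 ^ 2) atTop (𝓝 0) := by
      refine squeeze_zero (fun _ => by positivity) (fun p => ?_) h3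
      rw [dist_eq_norm, dist_eq_norm]
      exact hkey p.1 p.2
    have h5 := h4.sqrt
    simpa [Real.sqrt_sq dist_nonneg] using h5
  obtain ⟨u, hu⟩ := cauchySeq_tendsto_of_complete hcau
  obtain ⟨g, hg⟩ := cauchySeq_tendsto_of_complete hcau2
  have hlim : Tendsto v atTop (𝓝 (u, g)) := hu.prodMk_nhds hg
  have hmem : (u, g) ∈ sobolevGraph Ω :=
    isClosed_sobolevGraph.mem_of_tendsto hlim (Eventually.of_forall fun k => (hvS k).1)
  have hS : (u, g) ∈ S := by
    refine ⟨hmem, hK.mem_of_tendsto hu (Eventually.of_forall fun k => (hvS k).2.1), ?_⟩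
    refine tendsto_nhds_unique hu.norm ?_
    rw [funext fun k => (hvS k).2.2]
    exact tendsto_const_nhds
  have hE : energyForm V (u, g) = m := by
    have hl : Tendsto (fun k => (⟨v k, (hvS k).1⟩ : sobolevGraph Ω)) atTop (𝓝 ⟨(u, g), hmem⟩) :=
      tendsto_subtype_rng.mpr hlim
    exact tendsto_nhds_unique (((continuous_energyForm hV).tendsto ⟨(u, g), hmem⟩).comp hl) hve
  exact ⟨(u, g), hS, fun z hz => hE.trans_le (hm z hz)⟩

end Minimization

/-! ### Nonempty constraint sets and existence of HOMO and LUMO -/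

section Existence

variable {Ω : TopologicalSpace.Opens E3}

/-- Bump functions at distinct points; evaluation at these points recovers the coefficients of a
linear combination. -/
theorem exists_testFunction_biorthogonal (hne : (Ω : Set E3).Nonempty) (m : ℕ) :
    ∃ (x : Fin m → E3) (f : Fin m → TestFunction Ω ℂ ⊤),
      (∀ i, x i ∈ Ω) ∧ ∀ i j, f j (x i) = if i = j then 1 else 0 := by
  obtain ⟨a, ha⟩ := hne
  have hinf : (Ω : Set E3).Infinite := infinite_of_mem_nhds a (Ω.isOpen.mem_nhds ha)
  let x : Fin m → E3 := fun i => hinf.natEmbedding _ i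
  have hx : ∀ i, x i ∈ Ω := fun i => (hinf.natEmbedding _ i).2
  have hinj : Function.Injective x := fun i j h =>
    Fin.ext ((hinf.natEmbedding _).injective (Subtype.ext h))
  have hbump : ∀ j, ∃ f : TestFunction Ω ℂ ⊤, ∀ i, f (x i) = if i = j then 1 else 0 := fun j => by
    have hs : (Ω : Set E3) ∩ (x '' {i | i ≠ j})ᶜ ∈ 𝓝 (x j) := by
      refine inter_mem (Ω.isOpen.mem_nhds (hx j))
        ((Set.toFinite _).isClosed.isOpen_compl.mem_nhds ?_)
      rintro ⟨i, hi, hij⟩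
      exact hi (hinj hij)
    obtain ⟨η, h1, h2, h3, -, h5⟩ := exists_contDiff_tsupport_subset (n := ⊤) hs
    have hsub : tsupport (fun y => (η y : ℂ)) ⊆ tsupport η :=
      closure_mono fun y hy h => hy (by simp [h])
    refine ⟨⟨fun y => (η y : ℂ), Complex.ofRealCLM.contDiff.comp h3,
      h2.comp_left Complex.ofReal_zero, (hsub.trans h1).trans Set.inter_subset_left⟩, fun i => ?_⟩
    change (η (x i) : ℂ) = _
    split_ifs with h
    · rw [h, h5, Complex.ofReal_one]
    · rw [image_eq_zero_of_notMem_tsupport (f := η) fun hi => (h1 hi).2 ⟨i, h, rfl⟩,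
        Complex.ofReal_zero]
  choose f hf using hbump
  exact ⟨x, f, hx, fun i j => hf j i⟩

theorem testFunction_eq_zero_of_testGraph_fst_eq_zero {f : TestFunction Ω ℂ ⊤}
    (hf : (testGraph Ω f).1 = 0) {x : E3} (hx : x ∈ Ω) : f x = 0 := by
  have h : (f : E3 → ℂ) =ᵐ[volume.restrict (Ω : Set E3)] fun _ => 0 := by
    rw [testGraph_fst] at hf
    filter_upwards [(memLp_testFunction f 2 (volume.restrict (Ω : Set E3))).coeFn_toLp,
      Lp.coeFn_zero ℂ 2 (volume.restrict (Ω : Set E3))] with y h1 h2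
    rw [← h1, hf, h2, Pi.zero_apply]
  exact Measure.eqOn_open_of_ae_eq h Ω.isOpen f.continuous.continuousOn continuousOn_const hx

/-- `H¹₀(Ω)` contains unit vectors orthogonal to any finite family. -/
theorem exists_mem_sobolevGraph_orthogonal (hne : (Ω : Set E3).Nonempty) {n : ℕ}
    (φ : Fin n → L2 Ω) :
    ∃ w ∈ sobolevGraph Ω, (∀ i, inner ℂ (φ i) w.1 = 0) ∧ ‖w.1‖ = 1 := by
  obtain ⟨x, f, hx, hf⟩ := exists_testFunction_biorthogonal hne (n + 1)
  let L : (Fin (n + 1) → ℂ) →ₗ[ℂ] (Fin n → ℂ) := LinearMap.pi fun i =>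
    (innerSL ℂ (φ i)).toLinearMap ∘ₗ LinearMap.fst ℂ (L2 Ω) (L2Vec Ω) ∘ₗ testGraph Ω ∘ₗ
      Fintype.linearCombination ℂ f
  -- There are `n + 1` coefficients and only `n` orthogonality conditions.
  have hker : LinearMap.ker L ≠ ⊥ := LinearMap.ker_ne_bot_of_finrank_lt (by simp)
  obtain ⟨c, hc, hc0⟩ := Submodule.exists_mem_ne_zero_of_ne_bot hker
  set F : TestFunction Ω ℂ ⊤ := Fintype.linearCombination ℂ f c
  have hev : ∀ i, F (x i) = c i := fun i => by
    let ev : TestFunction Ω ℂ ⊤ →ₗ[ℂ] ℂ :=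
      { toFun := fun g => g (x i), map_add' := fun _ _ => rfl, map_smul' := fun _ _ => rfl }
    change ev (Fintype.linearCombination ℂ f c) = c i
    rw [Fintype.linearCombination_apply, map_sum]
    have : ∀ j, ev (f j) = if i = j then 1 else 0 := fun j => hf i j
    simp [this]
  have hF : (testGraph Ω F).1 ≠ 0 := fun h =>
    hc0 (funext fun i => by
      rw [← hev i, testFunction_eq_zero_of_testGraph_fst_eq_zero h (hx i), Pi.zero_apply])
  have hpos : ‖(testGraph Ω F).1‖ ≠ 0 := norm_ne_zero_iff.mpr hF
  refine ⟨((‖(testGraph Ω F).1‖⁻¹ : ℝ) : ℂ) • testGraph Ω F,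
    Submodule.smul_mem _ _ (testGraph_mem F), fun i => ?_, ?_⟩
  · have h : inner ℂ (φ i) (testGraph Ω F).1 = 0 := congrFun (LinearMap.mem_ker.mp hc) i
    rw [Prod.smul_fst, inner_smul_right, h, mul_zero]
  · rw [Prod.smul_fst, norm_smul, Complex.norm_real, norm_inv, norm_norm, inv_mul_cancel₀ hpos]

/-- Over an empty `Ω` the space `L²` is trivial and contains no unit vector; this is where `1 ≤ n`
enters the LUMO. -/
theorem nonempty_of_orthonormal {n : ℕ} (hn : 1 ≤ n) {φ : Fin n → L2 Ω} (hφ : Orthonormal ℂ φ) :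
    (Ω : Set E3).Nonempty := by
  by_contra h
  rw [Set.not_nonempty_iff_eq_empty] at h
  have h1 := hφ.1 ⟨0, hn⟩
  have h0 : φ ⟨0, hn⟩ = 0 := by
    apply Lp.ext
    have hae : ae (volume.restrict (Ω : Set E3)) = ⊥ := by
      rw [h, Measure.restrict_empty, ae_zero]
    rw [EventuallyEq, hae]
    exact eventually_bot
  rw [h0, norm_zero] at h1
  exact zero_ne_one h1

theorem inner_self_eq_one_iff {H : Type*} [NormedAddCommGroup H] [InnerProductSpace ℂ H] (u : H) :
    inner ℂ u u = 1 ↔ ‖u‖ = 1 := by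
  rw [inner_self_eq_norm_sq_to_K, ← RCLike.ofReal_pow]
  refine Complex.ofReal_eq_one.trans ?_
  exact pow_eq_one_iff_of_nonneg (norm_nonneg u) two_ne_zero

/-! ### The excitation functional -/

section Excitation

variable {n : ℕ} {exc : ℝ → ℝ} {Ωnuc : Set E3} {μ : Measure E3} {φ : Fin n → L2 Ω}

theorem memLp_effectivePotential (hΩ : Bornology.IsBounded (Ω : Set E3))
    (hexc : AdmissibleXC exc) [IsFiniteMeasure μ] :
    MemLp (fun x => vext Ωnuc μ x + vH φ x + vxc exc (density φ x)) (3 / 2)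
      (volume.restrict (Ω : Set E3)) :=
  ((memLp_vext hΩ Ωnuc μ).add (memLp_vH hΩ φ)).add (memLp_vxc hΩ hexc φ)

theorem excitationFunctional_eq_energyForm {w : L2 Ω × L2Vec Ω} (hw : w ∈ sobolevGraph Ω) :
    excitationFunctional exc Ωnuc μ φ w.1 =
      energyForm (fun x => vext Ωnuc μ x + vH φ x + vxc exc (density φ x)) w := by
  rw [excitationFunctional, weakGradient_eq_of_mem_sobolevGraph hw, integral_norm_sq_eq]
  rfl

theorem excitationWellDefined_of_mem_H10 (hΩ : Bornology.IsBounded (Ω : Set E3))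
    (hexc : AdmissibleXC exc) [IsFiniteMeasure μ] {χ : L2 Ω} (hχ : χ ∈ H10 Ω) :
    ExcitationWellDefined exc Ωnuc μ φ χ := by
  obtain ⟨w, hw, rfl⟩ : ∃ w ∈ sobolevGraph Ω, w.1 = χ :=
    ⟨_, mem_sobolevGraph_of_mem_H10 hχ, rfl⟩
  have h1 : ∀ᵐ x ∂(volume.restrict (Ω : Set E3)),
      IntegrableOn (fun y => 1 / ‖x - y‖) Ωnuc μ ∧
      IntegrableOn (fun y => density φ y / ‖x - y‖) (Ω : Set E3) := by
    filter_upwards [ae_integrable_inv_norm_sub hΩ (μ.restrict Ωnuc),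
      ae_integrableOn_density_div hΩ φ] with x hx hx'
    exact ⟨hx, hx'⟩
  have h2 : IntegrableOn (fun x => ‖weakGradient Ω w.1 x‖ ^ 2) (Ω : Set E3) :=
    (memLp_two_iff_integrable_sq_norm (Lp.aestronglyMeasurable _)).mp (Lp.memLp _)
  have h3 : ∀ V : E3 → ℝ, MemLp V (3 / 2) (volume.restrict (Ω : Set E3)) →
      IntegrableOn (fun x => V x * ‖w.1 x‖ ^ 2) (Ω : Set E3) :=
    fun V hV => integrable_potential_mul_norm_sq hV hw
  exact ⟨h1, h2, h3 _ (memLp_vext hΩ Ωnuc μ), h3 _ (memLp_vH hΩ φ), h3 _ (memLp_vxc hΩ hexc φ)⟩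

theorem exists_isMaxOn_homoSet (hn : 1 ≤ n) (hΩ : Bornology.IsBounded (Ω : Set E3))
    (hexc : AdmissibleXC exc) [IsFiniteMeasure μ] (hφ : φ ∈ admissibleOrbitals Ω n) :
    ∃ φH ∈ homoSet φ, IsMaxOn (excitationFunctional exc Ωnuc μ φ) (homoSet φ) φH := by
  obtain ⟨hH, hortho⟩ := hφ
  let b : Fin n → sobolevGraph Ω := fun i =>
    ⟨(φ i, weakGradient Ω (φ i)), mem_sobolevGraph_of_mem_H10 (hH i)⟩
  -- Orthonormality makes the first component of `T` an isometry onto the span, so the HOMO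
  -- candidates are the image of a compact sphere. Lifting to the graph makes the gradient term
  -- continuous as well.
  let T : EuclideanSpace ℂ (Fin n) → sobolevGraph Ω := fun c => ∑ i, c i • b i
  have hT : Continuous T := by fun_prop
  have hT1 : ∀ c, (T c : L2 Ω × L2Vec Ω).1 = ∑ i, c i • φ i := fun c => by
    simp [T, b, Prod.fst_sum]
  have hTn : ∀ c, ‖(T c : L2 Ω × L2Vec Ω).1‖ ^ 2 = ‖c‖ ^ 2 := fun c => by
    have h := hortho.inner_sum c c Finset.univ
    rw [← hT1, inner_self_eq_norm_sq_to_K] at h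
    rw [EuclideanSpace.norm_sq_eq]
    simp_rw [RCLike.conj_mul] at h
    exact_mod_cast h
  have hsphere : ∀ c : EuclideanSpace ℂ (Fin n), c ∈ Metric.sphere 0 1 ↔
      inner ℂ (T c : L2 Ω × L2Vec Ω).1 (T c : L2 Ω × L2Vec Ω).1 = 1 := fun c => by
    rw [inner_self_eq_one_iff, mem_sphere_zero_iff_norm,
      ← pow_eq_one_iff_of_nonneg (norm_nonneg c) two_ne_zero, ← hTn,
      pow_eq_one_iff_of_nonneg (norm_nonneg _) two_ne_zero]
  have hne : (Metric.sphere (0 : EuclideanSpace ℂ (Fin n)) 1).Nonempty :=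
    ⟨EuclideanSpace.single ⟨0, hn⟩ 1, by simp⟩
  obtain ⟨c, hc, hmax⟩ := (isCompact_sphere (0 : EuclideanSpace ℂ (Fin n)) 1).exists_isMaxOn hne
    (((continuous_energyForm (memLp_effectivePotential (Ωnuc := Ωnuc) (μ := μ) (φ := φ)
      hΩ hexc)).comp hT).continuousOn)
  refine ⟨(T c : L2 Ω × L2Vec Ω).1, ⟨?_, (hsphere c).mp hc⟩, ?_⟩
  · rw [hT1]
    exact Submodule.sum_mem _ fun i _ =>
      Submodule.smul_mem _ _ (Submodule.subset_span (Set.mem_range_self i))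
  · rintro χ ⟨hχ, hχ1⟩
    obtain ⟨d, rfl⟩ := (Submodule.mem_span_range_iff_exists_fun ℂ).mp hχ
    have hd : (T (WithLp.toLp 2 d) : L2 Ω × L2Vec Ω).1 = ∑ i, d i • φ i := hT1 _
    rw [← hd] at hχ1 ⊢
    have h := hmax ((hsphere _).mpr hχ1)
    simp only [Set.mem_ofPred_eq, Function.comp_apply] at h ⊢
    rw [excitationFunctional_eq_energyForm (T _).2, excitationFunctional_eq_energyForm (T _).2]
    exact h

theorem exists_isMinOn_lumoSet (hn : 1 ≤ n) (hΩ : Bornology.IsBounded (Ω : Set E3))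
    (hexc : AdmissibleXC exc) [IsFiniteMeasure μ] (hφ : Orthonormal ℂ φ) :
    ∃ φL ∈ lumoSet φ, IsMinOn (excitationFunctional exc Ωnuc μ φ) (lumoSet φ) φL := by
  -- The orthogonality constraint as a closed subspace of `L²`, so that it passes to the limit.
  let K : Submodule ℂ (L2 Ω) := ⨅ i, LinearMap.ker (innerSL ℂ (φ i)).toLinearMap
  have hKmem : ∀ u, u ∈ K ↔ ∀ i, inner ℂ (φ i) u = 0 := fun u => by
    simp [K, Submodule.mem_iInf]
  have hK : IsClosed (K : Set (L2 Ω)) := by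
    simp only [K, Submodule.coe_iInf]
    exact isClosed_iInter fun i => (innerSL ℂ (φ i)).isClosed_ker
  obtain ⟨w, hw, hwφ, hw1⟩ := exists_mem_sobolevGraph_orthogonal (nonempty_of_orthonormal hn hφ) φ
  obtain ⟨w₀, ⟨h0, h0K, h01⟩, hmin⟩ := exists_isMinOn_energyForm hΩ
    (memLp_effectivePotential (Ωnuc := Ωnuc) (μ := μ) (φ := φ) hΩ hexc) K hK
    ⟨w, hw, (hKmem _).mpr hwφ, hw1⟩
  refine ⟨w₀.1, ⟨mem_H10_of_mem_sobolevGraph h0, (hKmem _).mp h0K,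
    (inner_self_eq_one_iff _).mpr h01⟩, ?_⟩
  rintro χ ⟨hχ, hχφ, hχ1⟩
  have hz := mem_sobolevGraph_of_mem_H10 hχ
  have h := hmin (a := (χ, weakGradient Ω χ))
    ⟨hz, (hKmem _).mpr hχφ, (inner_self_eq_one_iff _).mp hχ1⟩
  have e1 := excitationFunctional_eq_energyForm (exc := exc) (Ωnuc := Ωnuc) (μ := μ) (φ := φ) h0
  have e2 := excitationFunctional_eq_energyForm (exc := exc) (Ωnuc := Ωnuc) (μ := μ) (φ := φ) hz
  simp only [Set.mem_ofPred_eq] at h ⊢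
  rw [e1]
  exact h.trans_eq e2.symm

end Excitation

end Existence

end KohnSham

end

theorem mainTheorem3 (n : ℕ) (hn : 1 ≤ n)
    (Ω : TopologicalSpace.Opens KohnSham.E3) (hΩ : Bornology.IsBounded (Ω : Set KohnSham.E3))
    (Ωnuc : Set KohnSham.E3) (hnuc : IsCompact Ωnuc) (hnucΩ : Ωnuc ⊆ (Ω : Set KohnSham.E3))
    (exc : ℝ → ℝ) (hexc : KohnSham.AdmissibleXC exc)
    (μ : Measure KohnSham.E3) (hμ : μ ∈ KohnSham.nuclearMeasures Ωnuc n)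
    (φ : Fin n → KohnSham.L2 Ω) (hφ : φ ∈ KohnSham.admissibleOrbitals Ω n) :
    (∀ χ ∈ KohnSham.H10 Ω, KohnSham.ExcitationWellDefined exc Ωnuc μ φ χ) ∧
    (∃ φH ∈ KohnSham.homoSet φ,
      IsMaxOn (KohnSham.excitationFunctional exc Ωnuc μ φ) (KohnSham.homoSet φ) φH) ∧
    (∃ φL ∈ KohnSham.lumoSet φ,
      IsMinOn (KohnSham.excitationFunctional exc Ωnuc μ φ) (KohnSham.lumoSet φ) φL) := by
  have := KohnSham.isFiniteMeasure_of_mem_nuclearMeasures hμ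
  exact ⟨fun χ hχ => KohnSham.excitationWellDefined_of_mem_H10 hΩ hexc hχ,
    KohnSham.exists_isMaxOn_homoSet hn hΩ hexc hφ,
    KohnSham.exists_isMinOn_lumoSet hn hΩ hexc hφ.2⟩
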